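/- Notation. For $0<q<1$ put $(a;q)_n=\prod_{i=0}^{n-1}(1-aq^i)$, $(a;q)_\infty=\prod_{i\ge 0}(1-aq^i)$, $\mathbb{R}_q^+=\{q^n : n\in\mathbb{Z}\}$ and $\int_0^\infty f(x)\,d_qx=(1-q)\sum_{n\in\mathbb{Z}}q^nf(q^n)$. For real $v>-1$ let $$j_v(x,q)=\sum_{n\ge 0}(-1)^n\frac{q^{n(n+1)/2}}{(q;q)_n(q^{v+1};q)_n}x^{2n},\qquad J_v(x,q)=\frac{(q^{v+1};q)_\infty}{(q;q)_\infty}x^v j_v(x,q),\qquad c_{q,v}=\frac{1}{1-q}\,\frac{(q^{2v+2};q^2)_\infty}{(q^2;q^2)_\infty}.$$ Let $\mathcal{L}_{q,1,v}$ be the space of real functions $f$ on $\mathbb{R}_q^+$ with $\int_0^\infty|f(x)|x^{2v+1}d_qx<\infty$. For $f\in\mathcal{L}_{q,1,v}$ and $x,y\in\mathbb{R}_q^+$ put $$\mathcal{F}_{q,v}f(x)=c_{q,v}\int_0^\infty f(t)j_v(xt,q^2)t^{2v+1}d_qt,\qquad T^v_{q,x}f(y)=c_{q,v}\int_0^\infty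 \mathcal{F}_{q,v}f(t)\,j_v(xt,q^2)j_v(yt,q^2)t^{2v+1}d_qt,$$ and for $x,y,z\in\mathbb{R}_q^+$ put $$D_v(x,y,z)=c_{q,v}^2\int_0^\infty j_v(xt,q^2)j_v(yt,q^2)j_v(zt,q^2)t^{2v+1}d_qt.$$ The operator $T^v_{q,x}$ is called positive if $T^v_{q,x}f\ge 0$ on $\mathbb{R}_q^+$ for every $f\in\mathcal{L}_{q,1,v}$ with $f\ge 0$, and $Q_v$ denotes the set of all $q\in\,]0,1[$ such that $T^v_{q,x}$ is positive for all $x\in\mathbb{R}_q^+$. Proposition 5. Let $-1<v<0$. Then $Q_v\subsetneq\,]0,1[$. Moreover, there is $q\in\,]0,1[$ with $J_0(1,q^2)\,J_v(1,q^2)<0$, and for every $q\in\,]0,1[$ with $J_0(1,q^2)\,J_v(1,q^2)<0$ there is an integer $i\ge 0$ such that $D_v(1,q^i,1)<0$. -/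

import Mathlib

/-! Basic objects of `q`-Bessel Fourier analysis, for a real order `v > -1` and a real base
`0 < q < 1`.  Only the values of functions on `{q ^ n | n ∈ ℤ}` matter throughout. -/

namespace QBessel

noncomputable section

/-- The finite `q`-shifted factorial `(a; q)_n = ∏_{i < n} (1 - a q^i)`. -/
def qPoch (a q : ℝ) (n : ℕ) : ℝ := ∏ i ∈ Finset.range n, (1 - a * q ^ i)

/-- The infinite `q`-shifted factorial `(a; q)_∞ = ∏_{i ≥ 0} (1 - a q^i)`. -/
def qPochInf (a q : ℝ) : ℝ := ∏' i : ℕ, (1 - a * q ^ i)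

/-- The Jackson `q`-integral `∫_0^∞ f(x) d_q x = (1 - q) ∑_{n ∈ ℤ} q^n f(q^n)`. -/
def jacksonIntegral (q : ℝ) (f : ℝ → ℝ) : ℝ :=
  (1 - q) * ∑' n : ℤ, q ^ n * f (q ^ n)

/-- The `q`-lattice `ℝ_q^+ = {q^n : n ∈ ℤ}`. -/
def qLattice (q : ℝ) : Set ℝ := Set.range fun n : ℤ => q ^ n

/-- Membership in the weighted space `L_{q,1,v}`: the `q`-integral of `|f(x)| x^{2v+1}` over
`[0, ∞[` is finite. -/
def MemL1 (q v : ℝ) (f : ℝ → ℝ) : Prop :=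
  Summable fun n : ℤ => q ^ n * (|f (q ^ n)| * (q ^ n : ℝ) ^ (2 * v + 1))

/-- The normalized Hahn-Exton `q`-Bessel function
`j_v(x, q) = ∑_n (-1)^n q^{n(n+1)/2} / ((q; q)_n (q^{v+1}; q)_n) x^{2n}`. -/
def besselNorm (v x q : ℝ) : ℝ :=
  ∑' n : ℕ, (-1) ^ n * (q ^ (n * (n + 1) / 2) / (qPoch q q n * qPoch (q ^ (v + 1)) q n))
    * x ^ (2 * n)

/-- The Hahn-Exton `q`-Bessel function
`J_v(x, q) = (q^{v+1}; q)_∞ / (q; q)_∞ x^v j_v(x, q)`. -/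
def besselJ (v x q : ℝ) : ℝ :=
  qPochInf (q ^ (v + 1)) q / qPochInf q q * x ^ v * besselNorm v x q

/-- The constant `c_{q,v} = (q^{2v+2}; q^2)_∞ / ((1 - q) (q^2; q^2)_∞)`. -/
def cConst (q v : ℝ) : ℝ :=
  1 / (1 - q) * (qPochInf (q ^ (2 * v + 2)) (q ^ 2) / qPochInf (q ^ 2) (q ^ 2))

/-- The `q`-Bessel Fourier transform. -/
def fourierBessel (q v : ℝ) (f : ℝ → ℝ) (x : ℝ) : ℝ :=
  cConst q v *
    jacksonIntegral q fun t => f t * besselNorm v (x * t) (q ^ 2) * t ^ (2 * v + 1)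

/-- The `q`-Bessel translation `T_{q,x}^v f (y)`. -/
def translation (q v x : ℝ) (f : ℝ → ℝ) (y : ℝ) : ℝ :=
  cConst q v *
    jacksonIntegral q fun t =>
      fourierBessel q v f t * besselNorm v (x * t) (q ^ 2) * besselNorm v (y * t) (q ^ 2)
        * t ^ (2 * v + 1)

/-- Positivity of the operator `T_{q,x}^v`: it maps nonnegative functions of `L_{q,1,v}` to
nonnegative functions on the lattice. -/
def TranslationPositive (q v x : ℝ) : Prop :=
  ∀ f : ℝ → ℝ, MemL1 q v f → (∀ t ∈ qLattice q, 0 ≤ f t) →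
    ∀ y ∈ qLattice q, 0 ≤ translation q v x f y

/-- The domain of positivity `Q_v`. -/
def positivityDomain (v : ℝ) : Set ℝ :=
  {q | q ∈ Set.Ioo (0 : ℝ) 1 ∧ ∀ x ∈ qLattice q, TranslationPositive q v x}

/-- The kernel `D_v(x, y, z)` of the translation (for the base `q`). -/
def kernelD (q v x y z : ℝ) : ℝ :=
  cConst q v ^ 2 *
    jacksonIntegral q fun t =>
      besselNorm v (x * t) (q ^ 2) * besselNorm v (y * t) (q ^ 2) * besselNorm v (z * t) (q ^ 2)
        * t ^ (2 * v + 1)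

end

end QBessel

open Filter Topology Finset

namespace QBessel

/-! ### Shifted factorials -/

/-! Put `p = q²` and `w = p^(v+1)`, so that `-1 < v < 0` means `p < w < 1`. On the lattice,
`j_v(q^n, q²)` is a positive constant times the Laurent coefficient `A_w(n)` of `(w/s; p)_∞ / (s;
p)_∞` (`besselNorm_zpow`); moreover `J_v(1, q²) = A_w(0)` and `J_0(1, q²) = A_p(0)`. Hence `D_v(1,
q^i, 1)` is a positive multiple of `∑_n w^n A_w(n)² A_w(n+i)`.

Two identities give the negative kernel value. By the `q`-binomial theorem there are weights `b_i >
0` for which `∑_i b_i A_w(n+i)` is a positive constant times `A_p(n)`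
(`tsum_binomWeight_mul_bessel`): they carry order `v` to order `0`. And `∑_n w^n A_w(n)² A_p(n) =
A_w(0) A_p(0)` (`tsum_laurentCoeff_sq_mul_bessel`). So `∑_i b_i D_v(1, q^i, 1)` is a positive
multiple of `J_v(1, q²) J_0(1, q²)`; if this product is negative, some `D_v(1, q^i, 1)` is negative.

A suitable `q` lies just below the first sign change of `A_p(0)`. For `p ≤ 0.44` one has `A_w(0) <
A_p(0)` (`laurentCoeff_zero_lt`), while `A_p(0)` is positive at `0.1` and negative at `0.44`;
slightly left of the first `p` with `A_p(0) ≤ 0`, `A_p(0)` is still positive and `A_w(0)` already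
negative. Finally, translating a point mass gives the kernel, so a negative kernel value destroys
positivity. -/

lemma qPoch_zero (a p : ℝ) : qPoch a p 0 = 1 := by simp [qPoch]

lemma qPoch_succ (a p : ℝ) (n : ℕ) : qPoch a p (n + 1) = qPoch a p n * (1 - a * p ^ n) := by
  simp [qPoch, prod_range_succ]

lemma qPoch_add (a p : ℝ) (n m : ℕ) :
    qPoch a p (n + m) = qPoch a p n * qPoch (a * p ^ n) p m := by
  simp only [qPoch, prod_range_add]
  congr 1
  refine prod_congr rfl fun i _ => ?_
  rw [pow_add]; ring

lemma qPoch_self_succ (p : ℝ) (n : ℕ) : qPoch p p (n + 1) = qPoch p p n * (1 - p ^ (n + 1)) := by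
  rw [qPoch_succ, pow_succ']

lemma one_sub_mul_pow_pos {a p : ℝ} (hp0 : 0 < p) (hp1 : p < 1) (ha1 : a < 1) (n : ℕ) :
    0 < 1 - a * p ^ n := by
  have h1 : p ^ n ≤ 1 := pow_le_one₀ hp0.le hp1.le
  have h2 : 0 < p ^ n := pow_pos hp0 n
  nlinarith

lemma qPoch_pos {a p : ℝ} (hp0 : 0 < p) (hp1 : p < 1) (ha1 : a < 1) (n : ℕ) :
    0 < qPoch a p n :=
  prod_pos fun i _ => one_sub_mul_pow_pos hp0 hp1 ha1 i

lemma multipliable_qPoch (a : ℝ) {p : ℝ} (hp0 : 0 < p) (hp1 : p < 1) :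
    Multipliable fun i : ℕ => 1 - a * p ^ i := by
  have h : Summable fun i : ℕ => -(a * p ^ i) :=
    ((summable_geometric_of_lt_one hp0.le hp1).mul_left a).neg
  simpa [sub_eq_add_neg] using Real.multipliable_one_add_of_summable h

lemma tendsto_qPoch (a : ℝ) {p : ℝ} (hp0 : 0 < p) (hp1 : p < 1) :
    Tendsto (qPoch a p) atTop (𝓝 (qPochInf a p)) :=
  (multipliable_qPoch a hp0 hp1).tendsto_prod_tprod_nat

lemma qPochInf_eq_mul (a : ℝ) {p : ℝ} (hp0 : 0 < p) (hp1 : p < 1) (n : ℕ) :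
    qPochInf a p = qPoch a p n * qPochInf (a * p ^ n) p := by
  have h1 := (tendsto_qPoch (a * p ^ n) hp0 hp1).const_mul (qPoch a p n)
  have h2 := (tendsto_add_atTop_iff_nat n).2 (tendsto_qPoch a hp0 hp1)
  refine tendsto_nhds_unique h2 (h1.congr fun m => ?_)
  rw [← qPoch_add, add_comm]

lemma antitone_qPoch {a p : ℝ} (hp0 : 0 < p) (hp1 : p < 1) (ha0 : 0 ≤ a) (ha1 : a < 1) :
    Antitone (qPoch a p) := by
  refine antitone_nat_of_succ_le fun n => ?_
  rw [qPoch_succ]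
  have := qPoch_pos hp0 hp1 ha1 n
  have h2 : 0 ≤ a * p ^ n := by positivity
  nlinarith

lemma qPochInf_le_qPoch {a p : ℝ} (hp0 : 0 < p) (hp1 : p < 1) (ha0 : 0 ≤ a) (ha1 : a < 1)
    (n : ℕ) : qPochInf a p ≤ qPoch a p n :=
  (antitone_qPoch hp0 hp1 ha0 ha1).le_of_tendsto (tendsto_qPoch a hp0 hp1) n

lemma qPochInf_pos {a p : ℝ} (hp0 : 0 < p) (hp1 : p < 1) (ha1 : a < 1) :
    0 < qPochInf a p := by
  refine lt_of_le_of_ne (ge_of_tendsto' (tendsto_qPoch a hp0 hp1)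
    fun n => (qPoch_pos hp0 hp1 ha1 n).le) (Ne.symm ?_)
  have h : Summable fun i : ℕ => ‖-(a * p ^ i)‖ :=
    ((summable_geometric_of_lt_one hp0.le hp1).mul_left a).neg.norm
  have := tprod_one_add_ne_zero_of_summable
    (fun i => by simpa [← sub_eq_add_neg] using (one_sub_mul_pow_pos hp0 hp1 ha1 i).ne') h
  simpa [sub_eq_add_neg, qPochInf] using this

/-- The reciprocal of `(p; p)_n`, extended by zero to negative indices. -/
noncomputable def recipPoch (p : ℝ) (n : ℤ) : ℝ := if n < 0 then 0 else (qPoch p p n.toNat)⁻¹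

lemma recipPoch_of_neg (p : ℝ) {n : ℤ} (hn : n < 0) : recipPoch p n = 0 := if_pos hn

@[simp] lemma recipPoch_natCast (p : ℝ) (n : ℕ) : recipPoch p n = (qPoch p p n)⁻¹ := by
  simp [recipPoch]

lemma recipPoch_nonneg {p : ℝ} (hp0 : 0 < p) (hp1 : p < 1) (n : ℤ) : 0 ≤ recipPoch p n := by
  unfold recipPoch
  split_ifs
  · rfl
  · exact (inv_pos.2 (qPoch_pos hp0 hp1 hp1 _)).le

lemma recipPoch_le {p : ℝ} (hp0 : 0 < p) (hp1 : p < 1) (n : ℤ) :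
    recipPoch p n ≤ (qPochInf p p)⁻¹ := by
  have h := qPochInf_pos hp0 hp1 hp1
  unfold recipPoch
  split_ifs
  · exact (inv_pos.2 h).le
  · exact inv_anti₀ h (qPochInf_le_qPoch hp0 hp1 hp0.le hp1 _)

/-- For `n < 0` one factor of the product is zero, which is why `recipPoch` is extended by zero to
negative indices. -/
lemma qPochInf_zpow {p : ℝ} (hp0 : 0 < p) (hp1 : p < 1) (n : ℤ) :
    qPochInf (p ^ (n + 1)) p = qPochInf p p * recipPoch p n := by
  rcases lt_or_ge n 0 with hn | hn
  · rw [recipPoch_of_neg p hn, mul_zero]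
    obtain ⟨m, hm⟩ : ∃ m : ℕ, n + 1 = -(m : ℤ) := ⟨(-(n + 1)).toNat, by omega⟩
    rw [qPochInf_eq_mul _ hp0 hp1 (m + 1), qPoch_succ, hm]
    have : (1 : ℝ) - p ^ (-(m : ℤ)) * p ^ m = 0 := by
      rw [zpow_neg, zpow_natCast, inv_mul_cancel₀ (pow_pos hp0 m).ne', sub_self]
    rw [this]; ring
  · lift n to ℕ using hn
    have h := (qPoch_pos hp0 hp1 hp1 n).ne'
    rw [recipPoch_natCast, qPochInf_eq_mul p hp0 hp1 n, ← pow_succ']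
    norm_cast
    field_simp

/-! ### Euler's expansion of the infinite shifted factorial -/

/-- The coefficients of the power series of `(z; p)_∞`. -/
noncomputable def eulerCoeff (p : ℝ) (k : ℕ) : ℝ := (-1) ^ k * p ^ (k.choose 2) / qPoch p p k

lemma choose_two_succ (k : ℕ) : (k + 1).choose 2 = k.choose 2 + k := by
  rw [Nat.choose_succ_succ' k 1, Nat.choose_one_right, add_comm]

lemma choose_two_add (a b : ℕ) : (a + b).choose 2 = a.choose 2 + b.choose 2 + a * b := by
  induction b with
  | zero => simp
  | succ b ih => rw [← add_assoc, choose_two_succ, ih, choose_two_succ]; ring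

lemma eulerCoeff_zero (p : ℝ) : eulerCoeff p 0 = 1 := by simp [eulerCoeff, qPoch_zero]

lemma eulerCoeff_succ {p : ℝ} (hp0 : 0 < p) (hp1 : p < 1) (k : ℕ) :
    eulerCoeff p (k + 1) * (1 - p ^ (k + 1)) = -(p ^ k * eulerCoeff p k) := by
  have h1 := (qPoch_pos hp0 hp1 hp1 k).ne'
  have h2 : 1 - p ^ (k + 1) ≠ 0 := by
    have := one_sub_mul_pow_pos hp0 hp1 hp1 k
    rw [← pow_succ'] at this; exact this.ne'
  rw [eulerCoeff, eulerCoeff, qPoch_self_succ, choose_two_succ]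
  field_simp
  ring

lemma summable_theta {r : ℝ} (hr0 : 0 < r) (hr1 : r < 1) (C : ℝ) :
    Summable fun k : ℕ => r ^ (k.choose 2) * C ^ k := by
  rcases eq_or_ne C 0 with rfl | hC
  · exact summable_of_ne_finset_zero (s := {0}) fun k hk => by
      rw [zero_pow (by simpa using hk), mul_zero]
  refine summable_of_ratio_test_tendsto_lt_one (l := 0) one_pos
    (Eventually.of_forall fun k => by positivity) ?_
  have h : Tendsto (fun k : ℕ => r ^ k * |C|) atTop (𝓝 0) := by
    simpa using (tendsto_pow_atTop_nhds_zero_of_lt_one hr0.le hr1).mul_const |C|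
  refine h.congr fun k => ?_
  have : |C| ≠ 0 := abs_ne_zero.2 hC
  rw [choose_two_succ, norm_mul, norm_mul, norm_pow, norm_pow, norm_pow, norm_pow,
    Real.norm_eq_abs, Real.norm_eq_abs, abs_of_pos hr0, pow_add, pow_succ]
  field_simp

lemma abs_eulerCoeff {p : ℝ} (hp0 : 0 < p) (hp1 : p < 1) (k : ℕ) :
    |eulerCoeff p k| = p ^ (k.choose 2) * recipPoch p k := by
  rw [eulerCoeff, abs_div, abs_mul, abs_pow, abs_neg, abs_one, one_pow, one_mul,
    abs_of_pos (pow_pos hp0 _), abs_of_pos (qPoch_pos hp0 hp1 hp1 k), recipPoch_natCast,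
    div_eq_mul_inv]

lemma abs_eulerCoeff_le {p : ℝ} (hp0 : 0 < p) (hp1 : p < 1) (k : ℕ) :
    |eulerCoeff p k| ≤ (qPochInf p p)⁻¹ * p ^ (k.choose 2) := by
  rw [abs_eulerCoeff hp0 hp1, mul_comm]
  exact mul_le_mul_of_nonneg_right (recipPoch_le hp0 hp1 k) (pow_pos hp0 _).le

lemma summable_abs_eulerCoeff_mul_pow {p : ℝ} (hp0 : 0 < p) (hp1 : p < 1) (z : ℝ) :
    Summable fun k => |eulerCoeff p k * z ^ k| := by
  refine Summable.of_nonneg_of_le (fun _ => abs_nonneg _) (fun k => ?_)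
    ((summable_theta hp0 hp1 |z|).mul_left (qPochInf p p)⁻¹)
  rw [abs_mul, abs_pow, ← mul_assoc]
  exact mul_le_mul_of_nonneg_right (abs_eulerCoeff_le hp0 hp1 k) (by positivity)

lemma summable_eulerCoeff_mul_pow {p : ℝ} (hp0 : 0 < p) (hp1 : p < 1) (z : ℝ) :
    Summable fun k => eulerCoeff p k * z ^ k :=
  (summable_abs_eulerCoeff_mul_pow hp0 hp1 z).of_abs

lemma tsum_eulerCoeff_functional {p : ℝ} (hp0 : 0 < p) (hp1 : p < 1) (z : ℝ) :
    ∑' k, eulerCoeff p k * z ^ k = (1 - z) * ∑' k, eulerCoeff p k * (z * p) ^ k := by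
  have h1 := summable_eulerCoeff_mul_pow hp0 hp1 z
  have h2 := summable_eulerCoeff_mul_pow hp0 hp1 (z * p)
  have h3 : ∑' k, eulerCoeff p k * z ^ k - ∑' k, eulerCoeff p k * (z * p) ^ k
      = -z * ∑' k, eulerCoeff p k * (z * p) ^ k := by
    rw [← h1.tsum_sub h2, (h1.sub h2).tsum_eq_zero_add, ← tsum_mul_left]
    simp only [pow_zero, sub_self, zero_add]
    refine tsum_congr fun k => ?_
    have := eulerCoeff_succ hp0 hp1 k
    rw [mul_pow, mul_pow]
    linear_combination z ^ (k + 1) * this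
  linear_combination h3

/-- Iterating the functional equation moves the argument to `z p^n → 0`, where the series tends to
`1`. -/
lemma tsum_eulerCoeff {p : ℝ} (hp0 : 0 < p) (hp1 : p < 1) (z : ℝ) :
    ∑' k, eulerCoeff p k * z ^ k = qPochInf z p := by
  have key : ∀ n : ℕ, ∑' k, eulerCoeff p k * z ^ k
      = qPoch z p n * ∑' k, eulerCoeff p k * (z * p ^ n) ^ k := by
    intro n
    induction n with
    | zero => simp [qPoch_zero]
    | succ n ih =>
      rw [ih, tsum_eulerCoeff_functional hp0 hp1, qPoch_succ, pow_succ]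
      ring_nf
  have hlim : Tendsto (fun n : ℕ => ∑' k, eulerCoeff p k * (z * p ^ n) ^ k) atTop
      (𝓝 (∑' k, eulerCoeff p k * (0 : ℝ) ^ k)) := by
    refine tendsto_tsum_of_dominated_convergence
      (summable_abs_eulerCoeff_mul_pow hp0 hp1 z) (fun k => ?_)
      (Eventually.of_forall fun n k => ?_)
    · have : Tendsto (fun n : ℕ => z * p ^ n) atTop (𝓝 0) := by
        simpa using (tendsto_pow_atTop_nhds_zero_of_lt_one hp0.le hp1).const_mul z
      exact (this.pow k).const_mul _
    · rw [Real.norm_eq_abs, abs_mul, abs_mul]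
      refine mul_le_mul_of_nonneg_left ?_ (abs_nonneg _)
      rw [abs_pow, abs_pow, abs_mul]
      refine pow_le_pow_left₀ (by positivity) ?_ k
      refine mul_le_of_le_one_right (abs_nonneg _) ?_
      rw [abs_of_pos (pow_pos hp0 n)]
      exact pow_le_one₀ hp0.le hp1.le
  have h0 : ∑' k, eulerCoeff p k * (0 : ℝ) ^ k = 1 := by
    rw [tsum_eq_single 0 fun k hk => by rw [zero_pow hk, mul_zero]]
    simp [eulerCoeff_zero]
  rw [h0] at hlim
  have := (tendsto_qPoch z hp0 hp1).mul hlim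
  rw [mul_one] at this
  exact tendsto_nhds_unique (tendsto_const_nhds.congr key) this

/-- The finite `q`-binomial theorem (Rothe's identity). -/
lemma sum_antidiagonal_eulerCoeff {p : ℝ} (hp0 : 0 < p) (hp1 : p < 1) (x : ℝ) (N : ℕ) :
    ∀ y : ℝ, ∑ ab ∈ antidiagonal N, recipPoch p ab.1 * x ^ ab.1 * (eulerCoeff p ab.2 * y ^ ab.2)
      = (∏ i ∈ range N, (x - y * p ^ i)) / qPoch p p N := by
  induction N with
  | zero => intro y; simp [qPoch_zero, eulerCoeff_zero]
  | succ N ih =>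
    intro y
    have hN : (1 : ℝ) - p ^ (N + 1) ≠ 0 := by
      have := one_sub_mul_pow_pos hp0 hp1 hp1 N
      rw [← pow_succ'] at this; exact this.ne'
    have hq := (qPoch_pos hp0 hp1 hp1 N).ne'
    -- Since `a + b = N + 1`, one has `1 - p^(N+1) = (1 - p^a) p^b + (1 - p^b)`. Each part lowers
    -- one index and leaves the degree-`N` sum at `y p`; together they give the factor `x - y`.
    have hsplit : (1 - p ^ (N + 1)) * ∑ ab ∈ antidiagonal (N + 1),
        recipPoch p ab.1 * x ^ ab.1 * (eulerCoeff p ab.2 * y ^ ab.2)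
        = ∑ ab ∈ antidiagonal (N + 1), (1 - p ^ ab.1) * recipPoch p ab.1 * x ^ ab.1 *
            (eulerCoeff p ab.2 * (y * p) ^ ab.2)
        + ∑ ab ∈ antidiagonal (N + 1), recipPoch p ab.1 * x ^ ab.1 *
            ((eulerCoeff p ab.2 * (1 - p ^ ab.2)) * y ^ ab.2) := by
      rw [mul_sum, ← sum_add_distrib]
      refine sum_congr rfl fun ab hab => ?_
      rw [← mem_antidiagonal.1 hab, pow_add, mul_pow]
      ring
    have h1 : ∑ ab ∈ antidiagonal (N + 1), (1 - p ^ ab.1) * recipPoch p ab.1 * x ^ ab.1 *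
        (eulerCoeff p ab.2 * (y * p) ^ ab.2)
        = x * ∑ ab ∈ antidiagonal N, recipPoch p ab.1 * x ^ ab.1 *
            (eulerCoeff p ab.2 * (y * p) ^ ab.2) := by
      rw [Nat.antidiagonal_succ, sum_cons, sum_map, mul_sum]
      simp only [pow_zero, sub_self, zero_mul, zero_add]
      refine sum_congr rfl fun ab _ => ?_
      have ha : (1 - p ^ (ab.1 + 1)) * recipPoch p ((ab.1 + 1 : ℕ) : ℤ) = recipPoch p ab.1 := by
        have := one_sub_mul_pow_pos hp0 hp1 hp1 ab.1
        have h := (qPoch_pos hp0 hp1 hp1 ab.1).ne'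
        rw [← pow_succ'] at this
        rw [recipPoch_natCast, recipPoch_natCast, qPoch_self_succ]
        field_simp
      simp only [Function.Embedding.prodMap, Function.Embedding.coeFn_mk, Prod.map,
        Function.Embedding.refl_apply, Nat.succ_eq_add_one]
      rw [ha, pow_succ]; ring
    have h2 : ∑ ab ∈ antidiagonal (N + 1), recipPoch p ab.1 * x ^ ab.1 *
        ((eulerCoeff p ab.2 * (1 - p ^ ab.2)) * y ^ ab.2)
        = -y * ∑ ab ∈ antidiagonal N, recipPoch p ab.1 * x ^ ab.1 *
            (eulerCoeff p ab.2 * (y * p) ^ ab.2) := by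
      rw [Nat.antidiagonal_succ', sum_cons, sum_map, mul_sum]
      simp only [pow_zero, sub_self, zero_mul, zero_add, mul_zero]
      refine sum_congr rfl fun ab _ => ?_
      simp only [Function.Embedding.prodMap, Function.Embedding.coeFn_mk, Prod.map,
        Function.Embedding.refl_apply, Nat.succ_eq_add_one]
      rw [eulerCoeff_succ hp0 hp1, pow_succ, mul_pow]; ring
    rw [h1, h2, ih (y * p)] at hsplit
    rw [eq_div_iff (by
      rw [qPoch_self_succ]; exact mul_ne_zero hq hN), qPoch_self_succ, prod_range_succ']
    have hprod : ∏ k ∈ range N, (x - y * p ^ (k + 1)) = ∏ i ∈ range N, (x - y * p * p ^ i) :=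
      prod_congr rfl fun i _ => by rw [pow_succ']; ring
    rw [hprod, pow_zero, mul_one]
    generalize ∑ ab ∈ antidiagonal (N + 1),
      recipPoch p ab.1 * x ^ ab.1 * (eulerCoeff p ab.2 * y ^ ab.2) = S at hsplit ⊢
    generalize ∏ i ∈ range N, (x - y * p * p ^ i) = P at hsplit ⊢
    field_simp at hsplit
    linear_combination hsplit

/-! ### Laurent coefficients of `(w / s; p)_∞ / (s; p)_∞` -/

/-- The coefficient of `s ^ n` in the Laurent expansion of `(w / s; p)_∞ / (s; p)_∞` on
`w < |s| < 1`. -/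
noncomputable def laurentCoeff (p w : ℝ) (n : ℤ) : ℝ :=
  ∑' k : ℕ, eulerCoeff p k * w ^ k * recipPoch p (n + k)

lemma abs_mul_recipPoch_le {p : ℝ} (hp0 : 0 < p) (hp1 : p < 1) (t : ℝ) (n : ℤ) :
    |t * recipPoch p n| ≤ |t| * (qPochInf p p)⁻¹ := by
  rw [abs_mul, abs_of_nonneg (recipPoch_nonneg hp0 hp1 n)]
  exact mul_le_mul_of_nonneg_left (recipPoch_le hp0 hp1 n) (abs_nonneg _)

lemma summable_abs_laurentCoeff_term {p : ℝ} (hp0 : 0 < p) (hp1 : p < 1) (w : ℝ) (n : ℤ) :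
    Summable fun k : ℕ => |eulerCoeff p k * w ^ k * recipPoch p (n + k)| :=
  Summable.of_nonneg_of_le (fun _ => abs_nonneg _)
    (fun _ => abs_mul_recipPoch_le hp0 hp1 _ _)
    ((summable_abs_eulerCoeff_mul_pow hp0 hp1 w).mul_right _)

lemma abs_tsum_le_tsum_of_abs_le {f g : ℕ → ℝ} (hg : Summable g) (h : ∀ k, |f k| ≤ g k) :
    |∑' k, f k| ≤ ∑' k, g k := by
  simpa using tsum_of_norm_bounded (f := f) hg.hasSum h

/-- The first `m` terms vanish, so the series starts at `k = m`; from `(j+m choose 2) ≥ (j choose 2)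
+ (m choose 2)` a Gaussian factor comes out. This gives the decay as `n → -∞`. -/
lemma abs_laurentCoeff_neg_le {p w : ℝ} (hp0 : 0 < p) (hp1 : p < 1) (hw0 : 0 < w)
    {n : ℤ} {m : ℕ} (hm : ∀ k < m, n + k < 0) :
    |laurentCoeff p w n| ≤ p ^ m.choose 2 * w ^ m *
      ((qPochInf p p)⁻¹ * (qPochInf p p)⁻¹ * ∑' j : ℕ, p ^ j.choose 2 * w ^ j) := by
  have hB : 0 < (qPochInf p p)⁻¹ := inv_pos.2 (qPochInf_pos hp0 hp1 hp1)
  have hth := summable_theta hp0 hp1 w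
  have hs := summable_abs_laurentCoeff_term hp0 hp1 w n
  have hshift : laurentCoeff p w n
      = ∑' j : ℕ, eulerCoeff p (j + m) * w ^ (j + m) * recipPoch p (n + (j + m : ℕ)) := by
    rw [laurentCoeff, ← hs.of_abs.sum_add_tsum_nat_add m]
    rw [sum_eq_zero fun k hk => ?_, zero_add]
    rw [recipPoch_of_neg _ (by exact_mod_cast hm k (mem_range.1 hk)), mul_zero]
  have hs2 := (summable_nat_add_iff m).2 hs
  have hle : ∀ j : ℕ, |eulerCoeff p (j + m) * w ^ (j + m) * recipPoch p (n + (j + m : ℕ))|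
      ≤ p ^ m.choose 2 * w ^ m * ((qPochInf p p)⁻¹ * (qPochInf p p)⁻¹ *
        (p ^ j.choose 2 * w ^ j)) := by
    intro j
    refine (abs_mul_recipPoch_le hp0 hp1 _ _).trans ?_
    rw [abs_mul, abs_of_pos (pow_pos hw0 _)]
    have h1 := abs_eulerCoeff_le hp0 hp1 (j + m)
    have h2 : p ^ ((j + m).choose 2) ≤ p ^ (j.choose 2) * p ^ (m.choose 2) := by
      rw [← pow_add]
      exact pow_le_pow_of_le_one hp0.le hp1.le (by rw [choose_two_add]; omega)
    have h3 := h1.trans (mul_le_mul_of_nonneg_left h2 hB.le)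
    have h4 : 0 ≤ w ^ (j + m) * (qPochInf p p)⁻¹ := by positivity
    have h5 := mul_le_mul_of_nonneg_right h3 h4
    rw [pow_add] at h5 ⊢
    linarith
  rw [hshift, ← tsum_mul_left, ← tsum_mul_left]
  exact abs_tsum_le_tsum_of_abs_le ((hth.mul_left _).mul_left _) hle

lemma exists_abs_laurentCoeff_le {p w : ℝ} (hp0 : 0 < p) (hp1 : p < 1) (hw0 : 0 < w) :
    ∃ K, 0 ≤ K ∧ (∀ n : ℕ, |laurentCoeff p w n| ≤ K) ∧
      ∀ m : ℕ, |laurentCoeff p w (-m)| ≤ K * (p ^ m.choose 2 * w ^ m) := by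
  have h1 : 0 < (qPochInf p p)⁻¹ := inv_pos.2 (qPochInf_pos hp0 hp1 hp1)
  have h2 : 0 ≤ ∑' j : ℕ, p ^ (j.choose 2) * w ^ j := tsum_nonneg fun j => by positivity
  refine ⟨(qPochInf p p)⁻¹ * (qPochInf p p)⁻¹ * ∑' j : ℕ, p ^ j.choose 2 * w ^ j,
    by positivity, fun n => ?_, fun m => ?_⟩
  · simpa using abs_laurentCoeff_neg_le hp0 hp1 hw0 (n := n) (m := 0) (by omega)
  · rw [mul_comm]
    exact abs_laurentCoeff_neg_le hp0 hp1 hw0 (by omega)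

/-- The symmetry of `(w; p)_∞ ₁φ₁(0; w; p, z)` in `w` and `z`, for `z = p ^ (n + 1)`. -/
lemma tsum_bessel_eq_laurentCoeff {p w : ℝ} (hp0 : 0 < p) (hp1 : p < 1) (hw0 : 0 < w)
    (hw1 : w < 1) (n : ℤ) :
    ∑' k : ℕ, eulerCoeff p k * (p ^ (n + 1)) ^ k / qPoch w p k
      = qPochInf p p / qPochInf w p * laurentCoeff p w n := by
  have hwi := (qPochInf_pos hp0 hp1 hw1).ne'
  have hsum : Summable (Function.uncurry fun k j : ℕ =>
      eulerCoeff p k * (p ^ (n + 1)) ^ k * (eulerCoeff p j * (w * p ^ k) ^ j)) := by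
    refine Summable.of_norm_bounded
      (g := fun x : ℕ × ℕ => |eulerCoeff p x.1 * (p ^ (n + 1)) ^ x.1| * |eulerCoeff p x.2 * w ^ x.2|)
      ((summable_abs_eulerCoeff_mul_pow hp0 hp1 _).mul_of_nonneg
        (summable_abs_eulerCoeff_mul_pow hp0 hp1 _) (fun _ => abs_nonneg _)
        (fun _ => abs_nonneg _)) ?_
    rintro ⟨k, j⟩
    simp only [Function.uncurry, norm_mul, Real.norm_eq_abs, abs_mul]
    refine mul_le_mul_of_nonneg_left (mul_le_mul_of_nonneg_left ?_ (abs_nonneg _)) (by positivity)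
    rw [abs_of_pos (by positivity), abs_of_pos (by positivity)]
    exact pow_le_pow_left₀ (by positivity)
      (mul_le_of_le_one_right hw0.le (pow_le_one₀ hp0.le hp1.le)) j
  -- `(w; p)_∞ / (w; p)_k = (w p^k; p)_∞` is expanded by Euler; in the other order of summation the
  -- sum over `k` is again Euler's series, for `(p^(n+j+1); p)_∞`.
  have h1 : qPochInf w p * ∑' k : ℕ, eulerCoeff p k * (p ^ (n + 1)) ^ k / qPoch w p k
      = ∑' k : ℕ, ∑' j : ℕ,
        eulerCoeff p k * (p ^ (n + 1)) ^ k * (eulerCoeff p j * (w * p ^ k) ^ j) := by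
    rw [← tsum_mul_left]
    refine tsum_congr fun k => ?_
    rw [tsum_mul_left, tsum_eulerCoeff hp0 hp1, qPochInf_eq_mul w hp0 hp1 k]
    have := (qPoch_pos hp0 hp1 hw1 k).ne'
    field_simp
  have h2 : ∑' j : ℕ, ∑' k : ℕ,
        eulerCoeff p k * (p ^ (n + 1)) ^ k * (eulerCoeff p j * (w * p ^ k) ^ j)
      = qPochInf p p * laurentCoeff p w n := by
    rw [laurentCoeff, ← tsum_mul_left]
    refine tsum_congr fun j => ?_
    have : ∀ k : ℕ, eulerCoeff p k * (p ^ (n + 1)) ^ k * (eulerCoeff p j * (w * p ^ k) ^ j)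
        = eulerCoeff p j * w ^ j * (eulerCoeff p k * (p ^ (n + j + 1)) ^ k) := by
      intro k
      have : (p ^ (n + j + 1) : ℝ) ^ k = (p ^ (n + 1)) ^ k * (p ^ k) ^ j := by
        rw [show n + j + 1 = (n + 1) + j by ring, zpow_add₀ hp0.ne', mul_pow, zpow_natCast,
          ← pow_mul, ← pow_mul, mul_comm j k]
      rw [this, mul_pow]; ring
    rw [tsum_congr this, tsum_mul_left, tsum_eulerCoeff hp0 hp1, qPochInf_zpow hp0 hp1]
    ring
  rw [← hsum.tsum_comm] at h1
  rw [div_mul_eq_mul_div, eq_div_iff hwi, mul_comm _ (qPochInf w p), h1, h2]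

/-! ### Moments of the squares of the Laurent coefficients -/

lemma tsum_antidiagonal_mul {f : ℕ → ℝ} {F : ℕ × ℕ → ℝ}
    (hs : Summable fun x : ℕ × ℕ => F x * f (x.1 + x.2)) :
    ∑' x : ℕ × ℕ, F x * f (x.1 + x.2) = ∑' N, (∑ x ∈ antidiagonal N, F x) * f N := by
  have hs' := (HasAntidiagonal.sigmaAntidiagonalEquivProd (A := ℕ)).summable_iff.2 hs
  rw [← (HasAntidiagonal.sigmaAntidiagonalEquivProd (A := ℕ)).tsum_eq]
  have h := hs'.tsum_sigma' fun N => (hasSum_fintype _).summable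
  simp only [Function.comp] at h
  rw [h]
  refine tsum_congr fun N => ?_
  rw [tsum_fintype, sum_mul, ← Finset.sum_attach (antidiagonal N) fun x => F x * f N,
    Finset.univ_eq_attach]
  refine Finset.sum_congr rfl fun (x : antidiagonal N) _ => ?_
  have := mem_antidiagonal.1 x.2
  simp [this]

lemma tsum_eulerCoeff_mul_recipPoch_sub {p : ℝ} (hp0 : 0 < p) (hp1 : p < 1) (y : ℝ) (N : ℕ) :
    ∑' j : ℕ, eulerCoeff p j * y ^ j * recipPoch p (N - j)
      = (∏ i ∈ range N, (1 - y * p ^ i)) / qPoch p p N := by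
  rw [← sum_antidiagonal_eulerCoeff hp0 hp1 1 N y, ← Nat.sum_antidiagonal_swap,
    Nat.sum_antidiagonal_eq_sum_range_succ_mk, tsum_eq_sum (s := range N.succ)]
  · refine sum_congr rfl fun j hj => ?_
    have : j ≤ N := Nat.lt_succ_iff.1 (mem_range.1 hj)
    simp only [Prod.swap]
    rw [Nat.cast_sub this, one_pow]; ring
  · intro j hj
    have : N < j := by simpa [Nat.lt_succ_iff] using hj
    rw [recipPoch_of_neg, mul_zero]
    omega

/-- Formally, with `F(s) = (w/s; p)_∞ / (s; p)_∞`, the left side is the constant term of `F(xs)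
F(w/s)`, a product of two `q`-binomial series in `s` and `1/s`. The proof rearranges the triple
series directly, which also covers small `x`, where the annuli of convergence need not meet. -/
lemma tsum_laurentCoeff_sq_mul_zpow {p w x : ℝ} (hp0 : 0 < p) (hp1 : p < 1) (hw0 : 0 < w)
    (hw1 : w < 1) (hx0 : 0 < x) (hx1 : x ≤ 1) :
    ∑' n : ℤ, (w * x) ^ n * laurentCoeff p w n ^ 2
      = ∑' N : ℕ, (∏ i ∈ range N, (x - p ^ i)) / qPoch p p N * (w ^ N *
          ((∏ i ∈ range N, (1 - x⁻¹ * p ^ i)) / qPoch p p N)) := by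
  obtain ⟨B, hB⟩ : ∃ B, B = (qPochInf p p)⁻¹ := ⟨_, rfl⟩
  have hB0 : 0 < B := hB ▸ inv_pos.2 (qPochInf_pos hp0 hp1 hp1)
  have hwx0 : 0 < w * x := mul_pos hw0 hx0
  have hwx1 : w * x < 1 := by nlinarith
  let h : ℤ × (ℕ × ℕ) → ℝ := fun t => (w * x) ^ t.1 *
    ((eulerCoeff p t.2.1 * w ^ t.2.1 * recipPoch p (t.1 + t.2.1)) *
      (eulerCoeff p t.2.2 * w ^ t.2.2 * recipPoch p (t.1 + t.2.2)))
  let g : (ℕ × ℕ) × ℕ → ℝ := fun t =>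
    recipPoch p t.1.1 * x ^ t.1.1 * eulerCoeff p t.1.2 *
      (w ^ (t.1.1 + t.1.2) *
        (eulerCoeff p t.2 * x⁻¹ ^ t.2 * recipPoch p ((t.1.1 + t.1.2 : ℕ) - t.2)))
  -- New index `a = n + j'`: terms with `a < 0` vanish. Summing over `j'` and then over `a + j = N`
  -- uses Rothe's identity twice.
  let ι : (ℕ × ℕ) × ℕ → ℤ × (ℕ × ℕ) := fun t => ((t.1.1 : ℤ) - t.2, (t.1.2, t.2))
  have hι : Function.Injective ι := by
    rintro ⟨⟨a, j⟩, j'⟩ ⟨⟨b, k⟩, k'⟩ H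
    simp only [ι, Prod.mk.injEq] at H ⊢
    omega
  have hgh : h ∘ ι = g := by
    funext ⟨⟨a, j⟩, j'⟩
    simp only [h, ι, g, Function.comp]
    rw [zpow_sub₀ hwx0.ne', zpow_natCast, zpow_natCast, mul_pow, mul_pow, pow_add, inv_pow,
      sub_add_cancel, show (a : ℤ) - j' + j = ((a + j : ℕ) : ℤ) - j' by push_cast; ring]
    field_simp
  have hsupp : ∀ t ∉ Set.range ι, h t = 0 := by
    rintro ⟨n, j, j'⟩ ht
    have : n + j' < 0 := by
      by_contra! hn
      refine ht ⟨(((n + j').toNat, j), j'), Prod.ext ?_ rfl⟩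
      simp only [ι]
      omega
    simp only [h]
    rw [recipPoch_of_neg p this]; simp
  have hgs : Summable g := by
    have h1 : Summable fun t : ℕ × ℕ => (w * x) ^ t.1 * |eulerCoeff p t.2 * w ^ t.2| :=
      (summable_geometric_of_lt_one hwx0.le hwx1).mul_of_nonneg
        (summable_abs_eulerCoeff_mul_pow hp0 hp1 w) (fun _ => by positivity)
        (fun _ => abs_nonneg _)
    have h2 := (h1.mul_of_nonneg (summable_abs_eulerCoeff_mul_pow hp0 hp1 x⁻¹)
      (fun _ => by positivity) (fun _ => abs_nonneg _)).mul_left (B * B)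
    refine Summable.of_norm_bounded h2 ?_
    rintro ⟨⟨a, j⟩, j'⟩
    have e1 := recipPoch_le hp0 hp1 a
    have e2 := recipPoch_le hp0 hp1 ((a + j : ℕ) - j')
    have e3 := recipPoch_nonneg hp0 hp1 a
    have e4 := recipPoch_nonneg hp0 hp1 ((a + j : ℕ) - j')
    simp only [g, norm_mul, Real.norm_eq_abs]
    rw [abs_of_nonneg e3, abs_of_nonneg e4, abs_mul (eulerCoeff p j), abs_mul (eulerCoeff p j'),
      abs_of_pos (pow_pos hx0 a), abs_of_pos (pow_pos hw0 j), abs_of_pos (pow_pos hw0 (a + j))]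
    calc _ = recipPoch p a * recipPoch p ((a + j : ℕ) - j') * ((w * x) ^ a *
          (|eulerCoeff p j| * w ^ j) * (|eulerCoeff p j'| * |x⁻¹ ^ j'|)) := by
            rw [mul_pow, pow_add]; ring
      _ ≤ B * B * ((w * x) ^ a * (|eulerCoeff p j| * w ^ j) *
          (|eulerCoeff p j'| * |x⁻¹ ^ j'|)) := by
            refine mul_le_mul_of_nonneg_right ?_ (by positivity)
            exact mul_le_mul (hB ▸ e1) (hB ▸ e2) e4 hB0.le
  have hhs : Summable h := (hι.summable_iff hsupp).1 (hgh ▸ hgs)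
  have hsum : ∑' t, h t = ∑' t, g t := by
    rw [← hgh]; exact (hι.tsum_eq (Function.support_subset_iff'.2 hsupp)).symm
  have hL : ∑' t, h t = ∑' n : ℤ, (w * x) ^ n * laurentCoeff p w n ^ 2 := by
    rw [hhs.tsum_prod]
    refine tsum_congr fun n => ?_
    have hs := summable_abs_laurentCoeff_term hp0 hp1 w n
    simp only [h]
    rw [tsum_mul_left, sq, laurentCoeff, tsum_mul_tsum_of_summable_norm hs.of_abs.norm hs.of_abs.norm]
  have hinner : ∀ t : ℕ × ℕ, ∑' j', g (t, j') = recipPoch p t.1 * x ^ t.1 * eulerCoeff p t.2 *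
      (w ^ (t.1 + t.2) * ((∏ i ∈ range (t.1 + t.2), (1 - x⁻¹ * p ^ i)) / qPoch p p (t.1 + t.2))) := by
    intro t
    simp only [g]
    rw [tsum_mul_left, tsum_mul_left, tsum_eulerCoeff_mul_recipPoch_sub hp0 hp1]
  have hos : Summable fun t : ℕ × ℕ => recipPoch p t.1 * x ^ t.1 * eulerCoeff p t.2 *
      (w ^ (t.1 + t.2) * ((∏ i ∈ range (t.1 + t.2), (1 - x⁻¹ * p ^ i)) / qPoch p p (t.1 + t.2))) :=
    hgs.prod.congr fun t => hinner t
  rw [← hL, hsum, hgs.tsum_prod, tsum_congr hinner]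
  rw [tsum_antidiagonal_mul (f := fun N =>
    w ^ N * ((∏ i ∈ range N, (1 - x⁻¹ * p ^ i)) / qPoch p p N)) (F := fun t =>
      recipPoch p t.1 * x ^ t.1 * eulerCoeff p t.2) hos]
  refine tsum_congr fun N => ?_
  have := sum_antidiagonal_eulerCoeff hp0 hp1 x N 1
  simp only [one_pow, mul_one, one_mul] at this
  rw [this]

/-! ### A sum of products of three Hahn-Exton functions -/

lemma two_mul_choose_two (m : ℕ) : (2 * m.choose 2 : ℤ) = m * (m - 1) := by
  induction m with
  | zero => simp
  | succ m ih => rw [choose_two_succ]; push_cast; linarith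

/-- With `l = k - m` the right side equals `l(l+1)/2 + m(m-1)/2`. It is the exponent of `p` in the
bound for the term `n = -m` of the double series below. -/
lemma gaussian_exponent_le (m k : ℕ) :
    |(k : ℤ) - m| - 1 ≤ m.choose 2 + m.choose 2 + k.choose 2 + (1 - m) * k := by
  have hm := two_mul_choose_two m
  have hk := two_mul_choose_two k
  have h0 : 0 ≤ (m : ℤ) * (m - 1) := by rw [← hm]; positivity
  obtain ⟨l, hl⟩ : ∃ l : ℤ, l = k - m := ⟨_, rfl⟩
  have h1 : 2 * |l| - 2 ≤ l * (l + 1) := by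
    rcases le_or_gt 0 l with h | h
    · rw [abs_of_nonneg h]; nlinarith [sq_nonneg (l - 1)]
    · rw [abs_of_neg h]
      rcases (show l = -1 ∨ l ≤ -2 by omega) with rfl | h
      · norm_num
      · nlinarith
  rw [← hl]
  have : (k : ℤ) = l + m := by omega
  rw [this] at hk ⊢
  nlinarith

lemma summable_pow_natAbs {r : ℝ} (hr0 : 0 < r) (hr1 : r < 1) :
    Summable fun n : ℤ => r ^ n.natAbs := by
  have := summable_geometric_of_lt_one hr0.le hr1
  exact Summable.of_nat_of_neg (by simpa using this) (by simpa using this)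

lemma summable_pow_natAbs_mul {p w : ℝ} (hp0 : 0 < p) (hp1 : p < 1) (hw0 : 0 < w)
    (hw1 : w < 1) :
    Summable fun x : ℤ × ℕ => w ^ x.1.natAbs * p ^ ((x.2 : ℤ) + min x.1 0).natAbs := by
  have h := (summable_pow_natAbs hw0 hw1).mul_of_nonneg (summable_pow_natAbs hp0 hp1)
    (fun _ => by positivity) (fun _ => by positivity)
  have hinj : Function.Injective fun x : ℤ × ℕ => (x.1, (x.2 : ℤ) + min x.1 0) := by
    rintro ⟨a, b⟩ ⟨c, d⟩ H
    simp only [Prod.mk.injEq] at H ⊢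
    obtain ⟨rfl, H⟩ := H
    exact ⟨rfl, by omega⟩
  refine (h.comp_injective hinj).congr fun x => ?_
  rfl

/-- For `n = -m` the factor `w^(2m)` from the squared coefficient outweighs `w^(-m)`, and the
Gaussian factors outweigh `p^((n+1)k)`. The shift `min n 0` in the majorant treats both signs of `n`
at once. -/
lemma summable_laurentCoeff_sq_mul_eulerCoeff {p w : ℝ} (hp0 : 0 < p) (hp1 : p < 1)
    (hw0 : 0 < w) (hw1 : w < 1) :
    Summable fun x : ℤ × ℕ => w ^ x.1 * laurentCoeff p w x.1 ^ 2 *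
      (eulerCoeff p x.2 * (p ^ (x.1 + 1)) ^ x.2 / qPoch p p x.2) := by
  obtain ⟨K, hK0, hK, hKneg⟩ := exists_abs_laurentCoeff_le hp0 hp1 hw0
  obtain ⟨B, hB⟩ : ∃ B, B = (qPochInf p p)⁻¹ := ⟨_, rfl⟩
  have hB0 : 0 < B := hB ▸ inv_pos.2 (qPochInf_pos hp0 hp1 hp1)
  refine Summable.of_norm_bounded
    ((summable_pow_natAbs_mul hp0 hp1 hw0 hw1).mul_left (K * K * (B * B) * p⁻¹)) ?_
  rintro ⟨n, k⟩
  have hq := qPoch_pos hp0 hp1 hp1 k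
  have hqB : (qPoch p p k)⁻¹ ≤ B := by
    simpa [hB] using recipPoch_le hp0 hp1 k
  have he : |eulerCoeff p k| ≤ B * p ^ k.choose 2 := hB ▸ abs_eulerCoeff_le hp0 hp1 k
  have hstart : ‖w ^ n * laurentCoeff p w n ^ 2 *
      (eulerCoeff p k * (p ^ (n + 1)) ^ k / qPoch p p k)‖
      ≤ w ^ n * (|laurentCoeff p w n| * |laurentCoeff p w n|) *
        (B * p ^ k.choose 2 * (p ^ (n + 1)) ^ k * B) := by
    rw [norm_mul, norm_mul, norm_div, norm_mul, norm_pow, sq, div_eq_mul_inv]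
    simp only [Real.norm_eq_abs]
    rw [abs_of_pos (zpow_pos hw0 n), abs_of_pos (pow_pos (zpow_pos hp0 (n + 1)) k),
      abs_of_pos hq]
    refine mul_le_mul_of_nonneg_left ?_ (by positivity)
    exact mul_le_mul (mul_le_mul_of_nonneg_right he (by positivity)) hqB (by positivity)
      (by positivity)
  refine hstart.trans ?_
  rcases le_or_gt 0 n with hn | hn
  · lift n to ℕ using hn
    have h1 : |laurentCoeff p w n| * |laurentCoeff p w n| ≤ K * K :=
      mul_le_mul (hK n) (hK n) (abs_nonneg _) hK0
    have h2 : p ^ k.choose 2 * (p ^ ((n : ℤ) + 1)) ^ k ≤ p⁻¹ * p ^ k := by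
      have e1 : p ^ k.choose 2 ≤ 1 := pow_le_one₀ hp0.le hp1.le
      have e2 : (p ^ ((n : ℤ) + 1)) ^ k ≤ p ^ k := by
        refine pow_le_pow_left₀ (by positivity) ?_ k
        norm_cast
        exact pow_le_of_le_one hp0.le hp1.le (by omega)
      have e3 : 1 ≤ p⁻¹ := (one_le_inv₀ hp0).2 hp1.le
      calc _ ≤ 1 * p ^ k := by gcongr
        _ ≤ _ := by gcongr
    have h3 : min (n : ℤ) 0 = 0 := by omega
    simp only [h3, add_zero, Int.natAbs_natCast]
    calc _ = (w ^ n * (B * B)) * ((|laurentCoeff p w n| * |laurentCoeff p w n|) *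
          (p ^ k.choose 2 * (p ^ ((n : ℤ) + 1)) ^ k)) := by rw [zpow_natCast]; ring
      _ ≤ (w ^ n * (B * B)) * ((K * K) * (p⁻¹ * p ^ k)) := by
          refine mul_le_mul_of_nonneg_left (mul_le_mul h1 h2 (by positivity) (by positivity))
            (by positivity)
      _ = _ := by ring
  · obtain ⟨m, rfl⟩ : ∃ m : ℕ, n = -(m : ℤ) := ⟨(-n).toNat, by omega⟩
    have h1 : |laurentCoeff p w (-m)| * |laurentCoeff p w (-m)| ≤
        (K * (p ^ m.choose 2 * w ^ m)) * (K * (p ^ m.choose 2 * w ^ m)) :=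
      mul_le_mul (hKneg m) (hKneg m) (abs_nonneg _) (by positivity)
    have h2 : p ^ m.choose 2 * p ^ m.choose 2 * p ^ k.choose 2 * (p ^ (-(m : ℤ) + 1)) ^ k
        ≤ p⁻¹ * p ^ ((k : ℤ) - m).natAbs := by
      have e1 : p ^ m.choose 2 * p ^ m.choose 2 * p ^ k.choose 2 * (p ^ (-(m : ℤ) + 1)) ^ k
          = p ^ ((m.choose 2 : ℤ) + m.choose 2 + k.choose 2 + (1 - m) * k) := by
        rw [show (-(m : ℤ) + 1) = 1 - m by ring, ← zpow_natCast (p ^ (1 - (m : ℤ))) k, ← zpow_mul,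
          ← zpow_natCast p (m.choose 2), ← zpow_natCast p (k.choose 2), ← zpow_add₀ hp0.ne',
          ← zpow_add₀ hp0.ne', ← zpow_add₀ hp0.ne']
      have e2 : p⁻¹ * p ^ ((k : ℤ) - m).natAbs = p ^ (|(k : ℤ) - m| - 1) := by
        rw [zpow_sub₀ hp0.ne', zpow_one, ← Int.natCast_natAbs, zpow_natCast]
        field_simp
      rw [e1, e2]
      exact zpow_le_zpow_right_of_le_one₀ hp0 hp1.le (gaussian_exponent_le m k)
    have h3 : (k : ℤ) + min (-(m : ℤ)) 0 = k - m := by omega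
    simp only [h3, Int.natAbs_neg, Int.natAbs_natCast]
    calc _ ≤ w ^ (-(m : ℤ)) * ((K * (p ^ m.choose 2 * w ^ m)) * (K * (p ^ m.choose 2 * w ^ m))) *
          (B * p ^ k.choose 2 * (p ^ (-(m : ℤ) + 1)) ^ k * B) := by
          refine mul_le_mul_of_nonneg_right ?_ (by positivity)
          exact mul_le_mul_of_nonneg_left h1 (by positivity)
      _ = (K * K * (B * B) * w ^ m) * (p ^ m.choose 2 * p ^ m.choose 2 * p ^ k.choose 2 *
          (p ^ (-(m : ℤ) + 1)) ^ k) := by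
          rw [zpow_neg, zpow_natCast]
          field_simp
      _ ≤ (K * K * (B * B) * w ^ m) * (p⁻¹ * p ^ ((k : ℤ) - m).natAbs) :=
          mul_le_mul_of_nonneg_left h2 (by positivity)
      _ = _ := by ring

lemma qPoch_mul_prod_pow_sub_pow (p : ℝ) (N j : ℕ) :
    qPoch p p j * ∏ i ∈ range N, (p ^ (N + j) - p ^ i)
      = (-1) ^ N * p ^ N.choose 2 * qPoch p p (N + j) := by
  induction N with
  | zero => simp
  | succ N ih =>
    have h : ∏ i ∈ range N, (p ^ (N + 1 + j) - p ^ (i + 1))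
        = p ^ N * ∏ i ∈ range N, (p ^ (N + j) - p ^ i) := by
      rw [← card_range N, ← prod_const, card_range, ← prod_mul_distrib]
      exact prod_congr rfl fun i _ => by rw [add_right_comm, pow_succ, pow_succ]; ring
    rw [prod_range_succ', h, show N + 1 + j = N + j + 1 by ring, qPoch_self_succ, choose_two_succ,
      pow_add p (N.choose 2), pow_succ (-1 : ℝ)]
    linear_combination (p ^ N * (p ^ (N + j + 1) - 1)) * ih

/-- At `x = p^k` with `k = N + j`, the `N`-th term of the moment formula, times the `k`-th Bessel
coefficient, splits into a function of `N` times a function of `j`: the sum over `N` becomes a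
Cauchy product. -/
lemma eulerCoeff_mul_moment_coeff {p : ℝ} (hp0 : 0 < p) (hp1 : p < 1) (w : ℝ) (N j : ℕ) :
    eulerCoeff p (N + j) * p ^ (N + j) / qPoch p p (N + j) *
      ((∏ i ∈ range N, (p ^ (N + j) - p ^ i)) / qPoch p p N *
        (w ^ N * ((∏ i ∈ range N, (1 - (p ^ (N + j))⁻¹ * p ^ i)) / qPoch p p N)))
      = (eulerCoeff p N * w ^ N / qPoch p p N) * (eulerCoeff p j * p ^ j / qPoch p p j) := by
  have h1 : ∏ i ∈ range N, (p ^ (N + j) - p ^ i)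
      = (-1) ^ N * p ^ N.choose 2 * qPoch p p (N + j) / qPoch p p j := by
    rw [eq_div_iff (qPoch_pos hp0 hp1 hp1 j).ne', ← qPoch_mul_prod_pow_sub_pow]; ring
  have h2 : ∏ i ∈ range N, (1 - (p ^ (N + j))⁻¹ * p ^ i)
      = (∏ i ∈ range N, (p ^ (N + j) - p ^ i)) / (p ^ (N + j)) ^ N := by
    rw [eq_div_iff (by positivity)]
    have : (p ^ (N + j)) ^ N = ∏ i ∈ range N, p ^ (N + j) := by simp
    rw [this, ← prod_mul_distrib]
    exact prod_congr rfl fun i _ => by field_simp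
  have h3 : p ^ (N + j).choose 2 * p ^ N.choose 2 * p ^ N
      = p ^ j.choose 2 * (p ^ (N + j)) ^ N := by
    rw [← pow_mul]
    simp only [← pow_add]
    congr 1
    rw [choose_two_add]
    have := two_mul_choose_two N
    zify
    linarith
  have q1 := (qPoch_pos hp0 hp1 hp1 (N + j)).ne'
  have q2 := (qPoch_pos hp0 hp1 hp1 N).ne'
  have q3 := (qPoch_pos hp0 hp1 hp1 j).ne'
  have h4 : ((-1 : ℝ) ^ N) * (-1) ^ N = 1 := by rw [← mul_pow]; simp
  rw [h2, h1, eulerCoeff, eulerCoeff, eulerCoeff, pow_add (-1 : ℝ)]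
  rw [pow_add p N j] at h3 ⊢
  field_simp
  linear_combination (w ^ N * (-1) ^ N * (-1) ^ N) * h3 +
    (w ^ N * p ^ j.choose 2 * (p ^ N * p ^ j) ^ N) * h4

/-- The sum of `w ^ n A_w(n) ^ 2 A_p(n)` over `n ∈ ℤ`, with `A` the Laurent coefficients, is
`A_w(0) A_p(0)`. -/
lemma tsum_laurentCoeff_sq_mul_bessel {p w : ℝ} (hp0 : 0 < p) (hp1 : p < 1)
    (hw0 : 0 < w) (hw1 : w < 1) :
    ∑' n : ℤ, w ^ n * laurentCoeff p w n ^ 2 *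
        ∑' k : ℕ, eulerCoeff p k * (p ^ (n + 1)) ^ k / qPoch p p k
      = laurentCoeff p w 0 * ∑' k : ℕ, eulerCoeff p k * p ^ k / qPoch p p k := by
  have hs := summable_laurentCoeff_sq_mul_eulerCoeff hp0 hp1 hw0 hw1
  have hterm (z : ℝ) : Summable fun k => ‖eulerCoeff p k * z ^ k / qPoch p p k‖ := by
    have := summable_abs_laurentCoeff_term hp0 hp1 z 0
    refine this.congr fun k => ?_
    rw [zero_add, recipPoch_natCast, div_eq_mul_inv, Real.norm_eq_abs]
  have hA : laurentCoeff p w 0 = ∑' k, eulerCoeff p k * w ^ k / qPoch p p k :=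
    tsum_congr fun k => by rw [zero_add, recipPoch_natCast, div_eq_mul_inv]
  -- For fixed `k` the sum over `n` is the moment at `x = p^k`. There the factor `x - p^k` kills
  -- every `N > k`, leaving a finite sum.
  have hstep : ∀ k : ℕ, ∑' n : ℤ, w ^ n * laurentCoeff p w n ^ 2 *
        (eulerCoeff p k * (p ^ (n + 1)) ^ k / qPoch p p k)
      = ∑ Nj ∈ antidiagonal k, (eulerCoeff p Nj.1 * w ^ Nj.1 / qPoch p p Nj.1) *
          (eulerCoeff p Nj.2 * p ^ Nj.2 / qPoch p p Nj.2) := by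
    intro k
    have h1 : ∀ n : ℤ, w ^ n * laurentCoeff p w n ^ 2 *
        (eulerCoeff p k * (p ^ (n + 1)) ^ k / qPoch p p k)
        = eulerCoeff p k * p ^ k / qPoch p p k *
          ((w * p ^ k) ^ n * laurentCoeff p w n ^ 2) := by
      intro n
      have : (p ^ (n + 1)) ^ k = p ^ k * (p ^ k) ^ n := by
        rw [zpow_add₀ hp0.ne', mul_pow, zpow_one, ← zpow_natCast (p ^ n) k, ← zpow_mul,
          ← zpow_natCast p k, ← zpow_mul, mul_comm n]
        ring
      rw [this, mul_zpow]; ring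
    rw [tsum_congr h1, tsum_mul_left, tsum_laurentCoeff_sq_mul_zpow hp0 hp1 hw0 hw1
      (pow_pos hp0 k) (pow_le_one₀ hp0.le hp1.le), tsum_eq_sum (s := range (k + 1)),
      Nat.sum_antidiagonal_eq_sum_range_succ_mk, mul_sum]
    · refine sum_congr rfl fun N hN => ?_
      obtain ⟨j, rfl⟩ := Nat.exists_eq_add_of_le (Nat.lt_succ_iff.1 (mem_range.1 hN))
      rw [Nat.add_sub_cancel_left]
      exact eulerCoeff_mul_moment_coeff hp0 hp1 w N j
    · intro N hN
      have hkN : k < N := by simpa using hN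
      rw [prod_eq_zero (mem_range.2 hkN) (sub_self _)]
      simp
  rw [hA, tsum_mul_tsum_eq_tsum_sum_antidiagonal_of_summable_norm (hterm w) (hterm p)]
  simp only [← tsum_mul_left]
  rw [← tsum_congr hstep]
  exact hs.tsum_comm.symm

/-! ### Positive weights raising `(w; p)_k` to `(p; p)_k` -/

/-- The coefficients `(p / w; p)_i w ^ i / (p; p)_i` of the `q`-binomial series. -/
noncomputable def binomWeight (p w : ℝ) (i : ℕ) : ℝ := qPoch (p / w) p i / qPoch p p i * w ^ i

section binomWeight

variable {p w : ℝ}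

/-- Positivity rests on `p / w < 1`, which for `w = p^(v+1)` is the condition `v < 0`. -/
lemma binomWeight_pos (hp0 : 0 < p) (hp1 : p < 1) (hpw : p < w) (i : ℕ) :
    0 < binomWeight p w i := by
  have hw0 := hp0.trans hpw
  have h1 := qPoch_pos hp0 hp1 ((div_lt_one hw0).2 hpw) i
  have h2 := qPoch_pos hp0 hp1 hp1 i
  unfold binomWeight
  positivity

lemma binomWeight_succ (hp0 : 0 < p) (hp1 : p < 1) (hpw : p < w) (i : ℕ) :
    binomWeight p w (i + 1) * (1 - p ^ (i + 1)) = binomWeight p w i * (w - p ^ (i + 1)) := by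
  have hw0 := (hp0.trans hpw).ne'
  have h2 := (qPoch_pos hp0 hp1 hp1 i).ne'
  have h3 : 1 - p ^ (i + 1) ≠ 0 := by
    have := one_sub_mul_pow_pos hp0 hp1 hp1 i
    rw [← pow_succ'] at this; exact this.ne'
  rw [binomWeight, binomWeight, qPoch_succ, qPoch_self_succ]
  field_simp
  ring

lemma summable_binomWeight (hp0 : 0 < p) (hp1 : p < 1) (hpw : p < w) (hw1 : w < 1) :
    Summable (binomWeight p w) := by
  have hw0 := hp0.trans hpw
  have h1 := (div_lt_one hw0).2 hpw
  refine Summable.of_nonneg_of_le (fun i => (binomWeight_pos hp0 hp1 hpw i).le) (fun i => ?_)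
    ((summable_geometric_of_lt_one hw0.le hw1).mul_left (qPochInf p p)⁻¹)
  refine mul_le_mul_of_nonneg_right ?_ (by positivity)
  have h2 : qPoch (p / w) p i ≤ 1 := by
    simpa [qPoch_zero] using antitone_qPoch hp0 hp1 (by positivity) h1 (Nat.zero_le i)
  have h3 : (qPoch p p i)⁻¹ ≤ (qPochInf p p)⁻¹ := by simpa using recipPoch_le hp0 hp1 i
  have h4 := inv_pos.2 (qPoch_pos hp0 hp1 hp1 i)
  rw [div_eq_mul_inv]
  exact (mul_le_of_le_one_left h4.le h2).trans h3

lemma summable_binomWeight_mul_pow (hp0 : 0 < p) (hp1 : p < 1) (hpw : p < w) (hw1 : w < 1)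
    {x : ℝ} (hx0 : 0 ≤ x) (hx1 : x ≤ 1) : Summable fun i => binomWeight p w i * x ^ i := by
  refine Summable.of_nonneg_of_le
    (fun i => mul_nonneg (binomWeight_pos hp0 hp1 hpw i).le (by positivity)) (fun i => ?_)
    (summable_binomWeight hp0 hp1 hpw hw1)
  exact mul_le_of_le_one_right (binomWeight_pos hp0 hp1 hpw i).le (pow_le_one₀ hx0 hx1)

/-- This is the equation satisfied by `(p x; p)_∞ / (w x; p)_∞`, the sum of the `q`-binomial series;
only its values at `x = p^k` are needed. -/
lemma tsum_binomWeight_functional (hp0 : 0 < p) (hp1 : p < 1) (hpw : p < w) (hw1 : w < 1)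
    {x : ℝ} (hx0 : 0 ≤ x) (hx1 : x ≤ 1) :
    (∑' i, binomWeight p w i * (x * p) ^ i) * (1 - p * x)
      = (∑' i, binomWeight p w i * x ^ i) * (1 - w * x) := by
  have h1 := summable_binomWeight_mul_pow hp0 hp1 hpw hw1 hx0 hx1
  have h2 := summable_binomWeight_mul_pow hp0 hp1 hpw hw1 (x := x * p) (by positivity)
    (mul_le_one₀ hx1 hp0.le hp1.le)
  have h3 : ∑' i, binomWeight p w i * x ^ i - ∑' i, binomWeight p w i * (x * p) ^ i
      = w * x * ∑' i, binomWeight p w i * x ^ i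
        - p * x * ∑' i, binomWeight p w i * (x * p) ^ i := by
    rw [← h1.tsum_sub h2, (h1.sub h2).tsum_eq_zero_add, ← tsum_mul_left, ← tsum_mul_left,
      ← (h1.mul_left _).tsum_sub (h2.mul_left _)]
    simp only [pow_zero, sub_self, zero_add]
    refine tsum_congr fun i => ?_
    have := binomWeight_succ hp0 hp1 hpw i
    rw [mul_pow, mul_pow]
    linear_combination x ^ (i + 1) * this
  linear_combination -h3

lemma tsum_binomWeight_mul_pow (hp0 : 0 < p) (hp1 : p < 1) (hpw : p < w) (hw1 : w < 1)
    (k : ℕ) : ∑' i, binomWeight p w i * (p ^ k) ^ i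
      = (∑' i, binomWeight p w i) * (qPoch w p k / qPoch p p k) := by
  induction k with
  | zero => simp [qPoch_zero]
  | succ k ih =>
    have h := tsum_binomWeight_functional hp0 hp1 hpw hw1 (pow_nonneg hp0.le k)
      (pow_le_one₀ hp0.le hp1.le)
    rw [ih, ← pow_succ, ← pow_succ'] at h
    have h2 := (qPoch_pos hp0 hp1 hp1 k).ne'
    have h3 : 1 - p ^ (k + 1) ≠ 0 := by
      have := one_sub_mul_pow_pos hp0 hp1 hp1 k
      rw [← pow_succ'] at this; exact this.ne'
    rw [qPoch_succ w, qPoch_self_succ, ← mul_left_inj' h3, h]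
    field_simp

lemma tsum_binomWeight_pos (hp0 : 0 < p) (hp1 : p < 1) (hpw : p < w) (hw1 : w < 1) :
    0 < ∑' i, binomWeight p w i :=
  (summable_binomWeight hp0 hp1 hpw hw1).tsum_pos (fun i => (binomWeight_pos hp0 hp1 hpw i).le) 0
    (binomWeight_pos hp0 hp1 hpw 0)

/-- Summing over `i` first multiplies the `k`-th term by a constant times `(w; p)_k / (p; p)_k`,
which replaces the denominator of order `v` by that of order `0`. -/
lemma tsum_binomWeight_mul_bessel (hp0 : 0 < p) (hp1 : p < 1) (hpw : p < w) (hw1 : w < 1)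
    (n : ℤ) :
    ∑' i : ℕ, binomWeight p w i *
        ∑' k : ℕ, eulerCoeff p k * (p ^ (n + i + 1)) ^ k / qPoch w p k
      = (∑' i, binomWeight p w i) * ∑' k : ℕ, eulerCoeff p k * (p ^ (n + 1)) ^ k / qPoch p p k := by
  have hw0 := hp0.trans hpw
  have hpow : ∀ i k : ℕ, (p ^ (n + i + 1)) ^ k = (p ^ (n + 1)) ^ k * (p ^ k) ^ i := by
    intro i k
    rw [show n + i + 1 = (n + 1) + i by ring, zpow_add₀ hp0.ne', mul_pow, zpow_natCast,
      ← pow_mul, ← pow_mul, mul_comm i k]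
  have hsum : Summable (Function.uncurry fun k i : ℕ => binomWeight p w i *
      (eulerCoeff p k * (p ^ (n + i + 1)) ^ k / qPoch w p k)) := by
    refine Summable.of_norm_bounded (((summable_abs_eulerCoeff_mul_pow hp0 hp1
      (p ^ (n + 1))).mul_of_nonneg (summable_binomWeight hp0 hp1 hpw hw1) (fun _ => abs_nonneg _)
      (fun i => (binomWeight_pos hp0 hp1 hpw i).le)).mul_left (qPochInf w p)⁻¹) ?_
    rintro ⟨k, i⟩
    simp only [Function.uncurry]
    rw [hpow, norm_mul, norm_div, ← mul_assoc (eulerCoeff p k), norm_mul (eulerCoeff p k * _)]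
    simp only [Real.norm_eq_abs]
    rw [abs_of_pos (binomWeight_pos hp0 hp1 hpw i), abs_of_pos (qPoch_pos hp0 hp1 hw1 k),
      abs_of_pos (pow_pos (pow_pos hp0 k) i), div_eq_mul_inv]
    have h1 : (p ^ k) ^ i ≤ 1 := pow_le_one₀ (by positivity) (pow_le_one₀ hp0.le hp1.le)
    have h2 : (qPoch w p k)⁻¹ ≤ (qPochInf w p)⁻¹ :=
      inv_anti₀ (qPochInf_pos hp0 hp1 hw1) (qPochInf_le_qPoch hp0 hp1 hw0.le hw1 k)
    have h3 := (binomWeight_pos hp0 hp1 hpw i).le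
    have h4 : 0 ≤ (qPoch w p k)⁻¹ := (inv_pos.2 (qPoch_pos hp0 hp1 hw1 k)).le
    calc _ ≤ binomWeight p w i * (|eulerCoeff p k * (p ^ (n + 1)) ^ k| * 1 * (qPochInf w p)⁻¹) := by
          refine mul_le_mul_of_nonneg_left ?_ h3
          exact mul_le_mul (mul_le_mul_of_nonneg_left h1 (abs_nonneg _)) h2 h4 (by positivity)
      _ = _ := by ring
  simp only [← tsum_mul_left]
  rw [hsum.tsum_comm]
  refine tsum_congr fun k => ?_
  have h : ∀ i : ℕ, binomWeight p w i * (eulerCoeff p k * (p ^ (n + i + 1)) ^ k / qPoch w p k)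
      = eulerCoeff p k * (p ^ (n + 1)) ^ k / qPoch w p k * (binomWeight p w i * (p ^ k) ^ i) := by
    intro i; rw [hpow]; ring
  rw [tsum_congr h, tsum_mul_left, tsum_binomWeight_mul_pow hp0 hp1 hpw hw1]
  have := (qPoch_pos hp0 hp1 hw1 k).ne'
  field_simp

lemma summable_zpow_mul_laurentCoeff_sq (hp0 : 0 < p) (hp1 : p < 1) (hw0 : 0 < w)
    (hw1 : w < 1) : Summable fun n : ℤ => w ^ n * laurentCoeff p w n ^ 2 := by
  have h := (summable_laurentCoeff_sq_mul_eulerCoeff hp0 hp1 hw0 hw1).comp_injective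
    (i := fun n : ℤ => (n, 0)) (fun a b hab => (Prod.mk.inj hab).1)
  refine h.congr fun n => ?_
  simp [eulerCoeff_zero, qPoch_zero]

lemma exists_abs_laurentCoeff_le_const (hp0 : 0 < p) (hp1 : p < 1) (hw0 : 0 < w)
    (hw1 : w < 1) : ∃ K, ∀ n : ℤ, |laurentCoeff p w n| ≤ K := by
  obtain ⟨K, hK0, hK, hKneg⟩ := exists_abs_laurentCoeff_le hp0 hp1 hw0
  refine ⟨K, fun n => ?_⟩
  obtain ⟨m, rfl | rfl⟩ := n.eq_nat_or_neg
  · exact hK m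
  · refine (hKneg m).trans (mul_le_of_le_one_right hK0 ?_)
    exact mul_le_one₀ (pow_le_one₀ hp0.le hp1.le) (by positivity) (pow_le_one₀ hw0.le hw1.le)

/-- The kernel summed against the positive weights. -/
lemma tsum_binomWeight_mul_kernel (hp0 : 0 < p) (hp1 : p < 1) (hpw : p < w) (hw1 : w < 1) :
    ∑' i : ℕ, binomWeight p w i *
        ∑' n : ℤ, w ^ n * laurentCoeff p w n ^ 2 * laurentCoeff p w (n + i)
      = qPochInf w p / qPochInf p p * (∑' i, binomWeight p w i) *
        (laurentCoeff p w 0 * laurentCoeff p p 0) := by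
  have hw0 := hp0.trans hpw
  have hP := (qPochInf_pos hp0 hp1 hp1).ne'
  have hW := (qPochInf_pos hp0 hp1 hw1).ne'
  obtain ⟨K, hK⟩ := exists_abs_laurentCoeff_le_const hp0 hp1 hw0 hw1
  have hsum : Summable (Function.uncurry fun (n : ℤ) (i : ℕ) => binomWeight p w i *
      (w ^ n * laurentCoeff p w n ^ 2 * laurentCoeff p w (n + i))) := by
    refine Summable.of_norm_bounded (((summable_zpow_mul_laurentCoeff_sq hp0 hp1 hw0
      hw1).mul_of_nonneg (summable_binomWeight hp0 hp1 hpw hw1) (fun _ => by positivity)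
      (fun i => (binomWeight_pos hp0 hp1 hpw i).le)).mul_left K) ?_
    rintro ⟨n, i⟩
    have h1 := binomWeight_pos hp0 hp1 hpw i
    have h2 : 0 ≤ w ^ n * laurentCoeff p w n ^ 2 := by positivity
    simp only [Function.uncurry]
    rw [norm_mul, norm_mul _ (laurentCoeff p w (n + i))]
    simp only [Real.norm_eq_abs]
    rw [abs_of_pos h1, abs_of_nonneg h2]
    calc _ ≤ binomWeight p w i * (w ^ n * laurentCoeff p w n ^ 2 * K) := by
          exact mul_le_mul_of_nonneg_left (mul_le_mul_of_nonneg_left (hK _) h2) h1.le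
      _ = _ := by ring
  have hinner : ∀ n : ℤ, ∑' i : ℕ, binomWeight p w i *
      (w ^ n * laurentCoeff p w n ^ 2 * laurentCoeff p w (n + i))
      = qPochInf w p / qPochInf p p * (∑' i, binomWeight p w i) *
        (w ^ n * laurentCoeff p w n ^ 2 *
          ∑' k : ℕ, eulerCoeff p k * (p ^ (n + 1)) ^ k / qPoch p p k) := by
    intro n
    have h := tsum_binomWeight_mul_bessel hp0 hp1 hpw hw1 n
    simp only [tsum_bessel_eq_laurentCoeff hp0 hp1 hw0 hw1] at h
    have e : ∀ i : ℕ, binomWeight p w i *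
        (w ^ n * laurentCoeff p w n ^ 2 * laurentCoeff p w (n + i))
        = qPochInf w p / qPochInf p p * (w ^ n * laurentCoeff p w n ^ 2) * (binomWeight p w i *
          (qPochInf p p / qPochInf w p * laurentCoeff p w (n + i))) := by
      intro i; field_simp
    rw [tsum_congr e, tsum_mul_left, h]; ring
  have hA : ∑' k : ℕ, eulerCoeff p k * p ^ k / qPoch p p k = laurentCoeff p p 0 :=
    tsum_congr fun k => by rw [zero_add, recipPoch_natCast, div_eq_mul_inv]
  rw [← hA, ← tsum_laurentCoeff_sq_mul_bessel hp0 hp1 hw0 hw1, ← tsum_mul_left]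
  simp only [← tsum_mul_left (a := binomWeight p w _)]
  rw [hsum.tsum_comm]
  exact tsum_congr hinner

end binomWeight

/-! ### Translation to Bessel functions and the translation kernel -/

section Bessel

lemma besselNorm_eq_tsum (v x p : ℝ) :
    besselNorm v x p
      = ∑' k : ℕ, eulerCoeff p k * (p * x ^ 2) ^ k / qPoch (p ^ (v + 1)) p k := by
  refine tsum_congr fun k => ?_
  have h : k * (k + 1) / 2 = k.choose 2 + k := by
    rw [← choose_two_succ, Nat.choose_two_right, Nat.add_sub_cancel, mul_comm]
  rw [h, eulerCoeff, pow_add, mul_pow, ← pow_mul, div_mul_eq_mul_div, div_div]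
  ring

variable {q v : ℝ}

lemma besselNorm_zpow (hq0 : 0 < q) (hq1 : q < 1) (hv : -1 < v) (n : ℤ) :
    besselNorm v (q ^ n) (q ^ 2) = qPochInf (q ^ 2) (q ^ 2) /
      qPochInf ((q ^ 2) ^ (v + 1)) (q ^ 2) * laurentCoeff (q ^ 2) ((q ^ 2) ^ (v + 1)) n := by
  have hp0 : 0 < q ^ 2 := by positivity
  have hp1 : q ^ 2 < 1 := pow_lt_one₀ hq0.le hq1 two_ne_zero
  have hw0 : 0 < (q ^ 2) ^ (v + 1) := Real.rpow_pos_of_pos hp0 _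
  have hw1 : (q ^ 2) ^ (v + 1) < 1 := Real.rpow_lt_one hp0.le hp1 (by linarith)
  rw [← tsum_bessel_eq_laurentCoeff hp0 hp1 hw0 hw1, besselNorm_eq_tsum]
  have : q ^ 2 * (q ^ n) ^ 2 = (q ^ 2) ^ (n + 1) := by
    rw [zpow_add₀ hp0.ne', zpow_one, mul_comm, ← zpow_natCast, ← zpow_natCast, ← zpow_mul,
      ← zpow_mul, mul_comm n]
  rw [this]

lemma besselJ_one (hq0 : 0 < q) (hq1 : q < 1) (hv : -1 < v) :
    besselJ v 1 (q ^ 2) = laurentCoeff (q ^ 2) ((q ^ 2) ^ (v + 1)) 0 := by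
  have hp0 : 0 < q ^ 2 := by positivity
  have hp1 : q ^ 2 < 1 := pow_lt_one₀ hq0.le hq1 two_ne_zero
  have hw1 : (q ^ 2) ^ (v + 1) < 1 := Real.rpow_lt_one hp0.le hp1 (by linarith)
  have h := besselNorm_zpow hq0 hq1 hv 0
  have hP := (qPochInf_pos hp0 hp1 hp1).ne'
  have hW := (qPochInf_pos hp0 hp1 hw1).ne'
  rw [zpow_zero] at h
  rw [besselJ, h, Real.one_rpow]
  field_simp

lemma zpow_mul_zpow_rpow (hq0 : 0 < q) (v : ℝ) (n : ℤ) :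
    q ^ n * (q ^ n) ^ (2 * v + 1) = ((q ^ 2) ^ (v + 1)) ^ n := by
  rw [← Real.rpow_intCast, ← Real.rpow_intCast, ← Real.rpow_natCast, ← Real.rpow_mul hq0.le,
    ← Real.rpow_mul hq0.le, ← Real.rpow_mul hq0.le, ← Real.rpow_add hq0]
  congr 1
  push_cast
  ring

lemma kernelD_one_eq (hq0 : 0 < q) (hq1 : q < 1) (hv : -1 < v) (i : ℕ) :
    kernelD q v 1 (q ^ i) 1 = cConst q v ^ 2 * (1 - q) *
      (qPochInf (q ^ 2) (q ^ 2) / qPochInf ((q ^ 2) ^ (v + 1)) (q ^ 2)) ^ 3 *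
      ∑' n : ℤ, ((q ^ 2) ^ (v + 1)) ^ n * laurentCoeff (q ^ 2) ((q ^ 2) ^ (v + 1)) n ^ 2 *
        laurentCoeff (q ^ 2) ((q ^ 2) ^ (v + 1)) (n + i) := by
  rw [kernelD, jacksonIntegral, mul_assoc (cConst q v ^ 2 * (1 - q)), mul_assoc (cConst q v ^ 2)]
  refine congrArg _ (congrArg _ ((tsum_congr fun n => ?_).trans tsum_mul_left))
  have h : (q : ℝ) ^ i * q ^ n = q ^ (n + i) := by
    rw [zpow_add₀ hq0.ne', zpow_natCast, mul_comm]
  rw [h, one_mul, besselNorm_zpow hq0 hq1 hv, besselNorm_zpow hq0 hq1 hv,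
    ← zpow_mul_zpow_rpow hq0]
  ring

lemma cConst_pos (hq0 : 0 < q) (hq1 : q < 1) (hv : -1 < v) : 0 < cConst q v := by
  have hp0 : 0 < q ^ 2 := by positivity
  have hp1 : q ^ 2 < 1 := pow_lt_one₀ hq0.le hq1 two_ne_zero
  have h1 := qPochInf_pos hp0 hp1 hp1
  have h2 := qPochInf_pos hp0 hp1 (Real.rpow_lt_one hq0.le hq1 (by linarith : 0 < 2 * v + 2))
  have h3 : 0 < 1 - q := by linarith
  unfold cConst
  positivity

/-- If `J_0(1, q²)` and `J_v(1, q²)` have opposite signs, the kernel takes a negative value. -/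
lemma exists_kernelD_neg (hq0 : 0 < q) (hq1 : q < 1) (hv : -1 < v) (hv0 : v < 0)
    (h : besselJ 0 1 (q ^ 2) * besselJ v 1 (q ^ 2) < 0) :
    ∃ i : ℕ, kernelD q v 1 (q ^ i) 1 < 0 := by
  have hp0 : 0 < q ^ 2 := by positivity
  have hp1 : q ^ 2 < 1 := pow_lt_one₀ hq0.le hq1 two_ne_zero
  have hw1 : (q ^ 2) ^ (v + 1) < 1 := Real.rpow_lt_one hp0.le hp1 (by linarith)
  have hpw : q ^ 2 < (q ^ 2) ^ (v + 1) := by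
    simpa using Real.rpow_lt_rpow_of_exponent_gt hp0 hp1 (show v + 1 < 1 by linarith)
  rw [besselJ_one hq0 hq1 hv, besselJ_one hq0 hq1 (by norm_num), zero_add, Real.rpow_one] at h
  -- If no kernel value were negative, their sum against positive weights would be nonnegative, yet
  -- it is a positive multiple of the negative product `h`.
  by_contra! hall
  have hc := cConst_pos hq0 hq1 hv
  have h1 := qPochInf_pos hp0 hp1 hp1
  have h2 := qPochInf_pos hp0 hp1 hw1
  have h3 : 0 < 1 - q := by linarith
  have hkey := tsum_binomWeight_mul_kernel hp0 hp1 hpw hw1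
  have hC := tsum_binomWeight_pos hp0 hp1 hpw hw1
  have hnonneg : 0 ≤ ∑' i : ℕ, binomWeight (q ^ 2) ((q ^ 2) ^ (v + 1)) i *
      ∑' n : ℤ, ((q ^ 2) ^ (v + 1)) ^ n * laurentCoeff (q ^ 2) ((q ^ 2) ^ (v + 1)) n ^ 2 *
        laurentCoeff (q ^ 2) ((q ^ 2) ^ (v + 1)) (n + i) := by
    refine tsum_nonneg fun i => mul_nonneg (binomWeight_pos hp0 hp1 hpw i).le ?_
    have := hall i
    rw [kernelD_one_eq hq0 hq1 hv] at this
    exact nonneg_of_mul_nonneg_right this (by positivity)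
  rw [hkey] at hnonneg
  have := nonneg_of_mul_nonneg_right hnonneg (by positivity)
  linarith

end Bessel

/-! ### Signs of the Hahn-Exton functions at `1` -/

lemma alternating_tsum_le {f : ℕ → ℝ} (hf : Antitone f) (hs : Summable f) (k : ℕ) :
    ∑ i ∈ range (2 * k), (-1) ^ i * f i ≤ ∑' n, (-1) ^ n * f n := by
  have h : Summable fun n => (-1) ^ n * f n := by
    refine Summable.of_norm_bounded hs.abs fun n => ?_
    simp
  exact hf.alternating_series_le_tendsto h.hasSum.tendsto_sum_nat k

lemma laurentCoeff_zero (p w : ℝ) :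
    laurentCoeff p w 0 = ∑' k : ℕ, (-1) ^ k * (p ^ k.choose 2 / qPoch p p k ^ 2 * w ^ k) := by
  refine tsum_congr fun k => ?_
  rw [zero_add, recipPoch_natCast, eulerCoeff]
  ring

lemma div_qPoch_sq_succ {p : ℝ} (hp0 : 0 < p) (hp1 : p < 1) (k : ℕ) :
    p ^ (k + 1).choose 2 / qPoch p p (k + 1) ^ 2 * (1 - p ^ (k + 1)) ^ 2
      = p ^ k.choose 2 / qPoch p p k ^ 2 * p ^ k := by
  have h2 := (qPoch_pos hp0 hp1 hp1 k).ne'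
  have h3 : 1 - p ^ (k + 1) ≠ 0 := by
    have := one_sub_mul_pow_pos hp0 hp1 hp1 k
    rw [← pow_succ'] at this; exact this.ne'
  rw [qPoch_self_succ, choose_two_succ, pow_add]
  field_simp

lemma summable_div_qPoch_sq_mul_pow {p : ℝ} (hp0 : 0 < p) (hp1 : p < 1) (w : ℝ) :
    Summable fun k : ℕ => p ^ k.choose 2 / qPoch p p k ^ 2 * w ^ k := by
  refine (summable_abs_laurentCoeff_term hp0 hp1 w 0).of_abs.alternating.congr fun k => ?_
  rw [zero_add, recipPoch_natCast, eulerCoeff]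
  have : ((-1 : ℝ) ^ k) * (-1) ^ k = 1 := by rw [← mul_pow]; simp
  linear_combination (p ^ k.choose 2 / qPoch p p k ^ 2 * w ^ k) * this

lemma laurentCoeff_zero_eq_one_sub {p : ℝ} (hp0 : 0 < p) (hp1 : p < 1) (w : ℝ) :
    laurentCoeff p w 0 = 1 - ∑' k : ℕ, (-1) ^ k *
      (p ^ (k + 1).choose 2 / qPoch p p (k + 1) ^ 2 * w ^ (k + 1)) := by
  have h' : Summable fun k : ℕ => (-1) ^ k * (p ^ k.choose 2 / qPoch p p k ^ 2 * w ^ k) :=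
    (summable_div_qPoch_sq_mul_pow hp0 hp1 w).alternating
  rw [laurentCoeff_zero, h'.tsum_eq_zero_add, sub_eq_add_neg, ← tsum_neg]
  congr 1
  · simp [qPoch_zero]
  · exact tsum_congr fun k => by rw [pow_succ (-1 : ℝ)]; ring

/-- This makes the alternating series for `A_p(0) - A_w(0)` strictly decreasing in absolute value.
The bound `0.44` suffices because `0.44 * 1.44 < 0.65 < (1 - 0.44²)²`. -/
lemma pow_succ_mul_sub_lt {p w : ℝ} (hp0 : 0 < p) (hp : p ≤ 0.44) (hpw : p < w) (hw1 : w < 1)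
    (n : ℕ) :
    p ^ (n + 1) * (w ^ (n + 2) - p ^ (n + 2)) < (1 - p ^ (n + 2)) ^ 2 * (w ^ (n + 1) - p ^ (n + 1)) := by
  have hw0 := hp0.trans hpw
  have h1 : 0 < w ^ (n + 1) - p ^ (n + 1) := sub_pos.2 (pow_lt_pow_left₀ hpw hp0.le (by omega))
  have h2 : 0 ≤ w ^ n - p ^ n := sub_nonneg.2 (pow_le_pow_left₀ hp0.le hpw.le n)
  have h3 : w ^ (n + 2) - p ^ (n + 2) ≤ (w + p) * (w ^ (n + 1) - p ^ (n + 1)) := by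
    have : 0 ≤ w * p * (w ^ n - p ^ n) := by positivity
    have e : (w + p) * (w ^ (n + 1) - p ^ (n + 1)) - (w ^ (n + 2) - p ^ (n + 2))
        = w * p * (w ^ n - p ^ n) := by ring
    linarith
  have h4 : p ^ (n + 1) ≤ 0.44 :=
    (pow_le_of_le_one hp0.le (by linarith) (by omega)).trans hp
  have h5 : p ^ (n + 2) ≤ 0.1936 := by
    calc p ^ (n + 2) ≤ p ^ 2 := pow_le_pow_of_le_one hp0.le (by linarith) (by omega)
      _ ≤ 0.1936 := by nlinarith
  have h6 : 0 < p ^ (n + 1) := by positivity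
  have h7 : p ^ (n + 1) * (w + p) ≤ 0.44 * 1.44 :=
    mul_le_mul h4 (by linarith) (by positivity) (by norm_num)
  have h8 : (0.65 : ℝ) ≤ (1 - p ^ (n + 2)) ^ 2 := by nlinarith
  calc _ ≤ p ^ (n + 1) * ((w + p) * (w ^ (n + 1) - p ^ (n + 1))) :=
        mul_le_mul_of_nonneg_left h3 h6.le
    _ = p ^ (n + 1) * (w + p) * (w ^ (n + 1) - p ^ (n + 1)) := by ring
    _ < _ := mul_lt_mul_of_pos_right (by linarith) h1

lemma laurentCoeff_zero_lt {p w : ℝ} (hp0 : 0 < p) (hp : p ≤ 0.44) (hpw : p < w) (hw1 : w < 1) :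
    laurentCoeff p w 0 < laurentCoeff p p 0 := by
  have hp1 : p < 1 := by linarith
  set b : ℕ → ℝ := fun k => p ^ k.choose 2 / qPoch p p k ^ 2 with hb
  have hbpos : ∀ k, 0 < b k := fun k =>
    div_pos (pow_pos hp0 _) (pow_pos (qPoch_pos hp0 hp1 hp1 k) 2)
  set f : ℕ → ℝ := fun k => b (k + 1) * (w ^ (k + 1) - p ^ (k + 1)) with hf
  have hlt : ∀ n, f (n + 1) < f n := by
    intro n
    have h1 := div_qPoch_sq_succ hp0 hp1 (n + 1)
    have h2 : 0 < (1 - p ^ (n + 2)) ^ 2 := by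
      have := one_sub_mul_pow_pos hp0 hp1 hp1 (n + 1)
      rw [← pow_succ'] at this; positivity
    have h3 := mul_lt_mul_of_pos_left (pow_succ_mul_sub_lt hp0 hp hpw hw1 n) (hbpos (n + 1))
    refine lt_of_mul_lt_mul_left ?_ h2.le
    calc (1 - p ^ (n + 2)) ^ 2 * f (n + 1)
        = (b (n + 2) * (1 - p ^ (n + 2)) ^ 2) * (w ^ (n + 2) - p ^ (n + 2)) := by
          simp only [hf]; ring
      _ = b (n + 1) * (p ^ (n + 1) * (w ^ (n + 2) - p ^ (n + 2))) := by
          rw [show b (n + 2) * (1 - p ^ (n + 2)) ^ 2 = b (n + 1) * p ^ (n + 1) from h1]; ring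
      _ < b (n + 1) * ((1 - p ^ (n + 2)) ^ 2 * (w ^ (n + 1) - p ^ (n + 1))) := h3
      _ = _ := by simp only [hf]; ring
  have hsw := (summable_nat_add_iff 1).2 (summable_div_qPoch_sq_mul_pow hp0 hp1 w)
  have hsp := (summable_nat_add_iff 1).2 (summable_div_qPoch_sq_mul_pow hp0 hp1 p)
  have hfs : Summable f := (hsw.sub hsp).congr fun k => by simp only [hf, hb]; ring
  have hdiff : laurentCoeff p p 0 - laurentCoeff p w 0 = ∑' k, (-1) ^ k * f k := by
    rw [laurentCoeff_zero_eq_one_sub hp0 hp1, laurentCoeff_zero_eq_one_sub hp0 hp1,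
      sub_sub_sub_cancel_left, ← hsw.alternating.tsum_sub hsp.alternating]
    exact tsum_congr fun k => by simp only [hf, hb]; ring
  have := alternating_tsum_le (antitone_nat_of_succ_le fun n => (hlt n).le) hfs 1
  simp only [mul_one, sum_range_succ, range_zero, sum_empty, pow_zero, pow_one, one_mul, zero_add] at this
  have h01 := hlt 0
  rw [zero_add] at h01
  linarith

lemma div_qPoch_sq_mul_pow_succ_le {p : ℝ} (hp0 : 0 < p) (hp1 : p < 1) {n : ℕ}
    (h : p ^ (n + 1) ≤ (1 - p ^ (n + 1)) ^ 2) :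
    p ^ (n + 1).choose 2 / qPoch p p (n + 1) ^ 2 * p ^ (n + 1)
      ≤ p ^ n.choose 2 / qPoch p p n ^ 2 * p ^ n := by
  have h1 := div_qPoch_sq_succ hp0 hp1 n
  have h2 : 0 < p ^ (n + 1).choose 2 / qPoch p p (n + 1) ^ 2 :=
    div_pos (pow_pos hp0 _) (pow_pos (qPoch_pos hp0 hp1 hp1 _) 2)
  rw [← h1]
  exact mul_le_mul_of_nonneg_left h h2.le

lemma laurentCoeff_self_neg {p : ℝ} (hp : p = 0.44) : laurentCoeff p p 0 < 0 := by
  have hp0 : 0 < p := by rw [hp]; norm_num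
  have hp1 : p < 1 := by rw [hp]; norm_num
  -- The constant term is split off because `p / (1 - p)² > 1` at `p = 0.44`: the terms decrease
  -- only from index `1` on.
  have hanti : Antitone fun k : ℕ => p ^ (k + 1).choose 2 / qPoch p p (k + 1) ^ 2 *
      p ^ (k + 1) := by
    refine antitone_nat_of_succ_le fun n => div_qPoch_sq_mul_pow_succ_le hp0 hp1 ?_
    have h : p ^ (n + 1 + 1) ≤ p ^ 2 := pow_le_pow_of_le_one hp0.le hp1.le (by omega)
    have h2 : p ^ 2 = 0.1936 := by rw [hp]; norm_num
    nlinarith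
  have h := alternating_tsum_le hanti
    ((summable_nat_add_iff 1).2 (summable_div_qPoch_sq_mul_pow hp0 hp1 p)) 2
  rw [laurentCoeff_zero_eq_one_sub hp0 hp1]
  have : 1 < ∑ i ∈ range (2 * 2), (-1) ^ i * (p ^ (i + 1).choose 2 /
      qPoch p p (i + 1) ^ 2 * p ^ (i + 1)) := by
    rw [hp]
    norm_num [sum_range_succ, qPoch, prod_range_succ, Nat.choose]
  linarith

lemma laurentCoeff_self_pos {p : ℝ} (hp : p = 0.1) : 0 < laurentCoeff p p 0 := by
  have hp0 : 0 < p := by rw [hp]; norm_num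
  have hp1 : p < 1 := by rw [hp]; norm_num
  have hanti : Antitone fun k : ℕ => p ^ k.choose 2 / qPoch p p k ^ 2 * p ^ k := by
    refine antitone_nat_of_succ_le fun n => div_qPoch_sq_mul_pow_succ_le hp0 hp1 ?_
    have h : p ^ (n + 1) ≤ p := pow_le_of_le_one hp0.le hp1.le (by omega)
    nlinarith
  have h := alternating_tsum_le hanti (summable_div_qPoch_sq_mul_pow hp0 hp1 p) 1
  rw [laurentCoeff_zero]
  refine lt_of_lt_of_le ?_ h
  rw [hp]
  norm_num [sum_range_succ, qPoch, prod_range_succ, Nat.choose]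

lemma continuousOn_laurentCoeff_zero {s : ℝ} (hs : 0 < s) :
    ContinuousOn (fun p : ℝ => laurentCoeff p (p ^ s) 0) (Set.Icc 0.1 0.44) := by
  simp only [laurentCoeff_zero]
  obtain ⟨r, hr⟩ : ∃ r : ℝ, r = 0.44 := ⟨_, rfl⟩
  -- `c = 1 - 0.44` bounds every factor of `(p; p)_k` from below, so the `k`-th term is at most
  -- `r^(k choose 2) c^(-2k)`, uniformly in `p`.
  obtain ⟨c, hc⟩ : ∃ c : ℝ, c = 0.56 := ⟨_, rfl⟩
  have hr0 : 0 < r := by rw [hr]; norm_num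
  have hr1 : r < 1 := by rw [hr]; norm_num
  have hc0 : 0 < c := by rw [hc]; norm_num
  rw [← hr]
  refine continuousOn_tsum (fun k => ?_) (summable_theta hr0 hr1 (c ^ 2)⁻¹) (fun k p hp => ?_)
  · refine ContinuousOn.mul continuousOn_const (ContinuousOn.mul (ContinuousOn.div ?_ ?_ ?_) ?_)
    · fun_prop
    · unfold qPoch; fun_prop
    · intro p hp
      have hp0 : 0 < p := by linarith [hp.1]
      have hp1 : p < 1 := by linarith [hp.2]
      exact pow_ne_zero 2 (qPoch_pos hp0 hp1 hp1 k).ne'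
    · exact ContinuousOn.pow (continuousOn_id.rpow_const fun _ _ => Or.inr hs.le) k
  · have hp0 : 0 < p := by linarith [hp.1]
    have hp1 : p < 1 := by linarith [hp.2]
    have hq := qPoch_pos hp0 hp1 hp1 k
    have hw0 : 0 < p ^ s := Real.rpow_pos_of_pos hp0 s
    have hw1 : p ^ s ≤ 1 := (Real.rpow_lt_one hp0.le hp1 hs).le
    have hle : c ^ k ≤ qPoch p p k := by
      have : c ^ k = ∏ _i ∈ range k, c := by simp
      rw [this, qPoch]
      refine prod_le_prod (fun _ _ => hc0.le) fun i _ => ?_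
      rw [← pow_succ']
      have : p ^ (i + 1) ≤ p := pow_le_of_le_one hp0.le hp1.le (Nat.succ_ne_zero i)
      rw [hr] at hp
      rw [hc]
      linarith [hp.2]
    rw [norm_mul, norm_pow, norm_neg, norm_one, one_pow, one_mul, Real.norm_eq_abs,
      abs_of_pos (by positivity)]
    calc _ ≤ p ^ k.choose 2 / qPoch p p k ^ 2 * 1 :=
          mul_le_mul_of_nonneg_left (pow_le_one₀ hw0.le hw1) (by positivity)
      _ = p ^ k.choose 2 * (qPoch p p k ^ 2)⁻¹ := by rw [mul_one, div_eq_mul_inv]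
      _ ≤ r ^ k.choose 2 * ((c ^ k) ^ 2)⁻¹ := by
          refine mul_le_mul (pow_le_pow_left₀ hp0.le hp.2 _) ?_ (by positivity) (by positivity)
          exact inv_anti₀ (by positivity) (pow_le_pow_left₀ (by positivity) hle 2)
      _ = _ := by rw [inv_pow, ← pow_mul, ← pow_mul, mul_comm k]

lemma exists_laurentCoeff_mul_neg {s : ℝ} (hs0 : 0 < s) (hs1 : s < 1) :
    ∃ p ∈ Set.Ioo (0 : ℝ) 1, laurentCoeff p p 0 * laurentCoeff p (p ^ s) 0 < 0 := by
  have hc1 : ContinuousOn (fun p : ℝ => laurentCoeff p p 0) (Set.Icc 0.1 0.44) := by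
    simpa using continuousOn_laurentCoeff_zero one_pos
  have hc2 := continuousOn_laurentCoeff_zero hs0
  have hclosed : IsClosed (Set.Icc (0.1 : ℝ) 0.44 ∩ (fun p => laurentCoeff p p 0) ⁻¹' Set.Iic 0) :=
    hc1.preimage_isClosed_of_isClosed isClosed_Icc isClosed_Iic
  have hcompact := isCompact_Icc.of_isClosed_subset hclosed Set.inter_subset_left
  -- `p₀` is the first point of `[0.1, 0.44]` with `A_p(0) ≤ 0`. There `A_w(0) < 0` strictly, which
  -- persists to the left, where minimality gives `A_p(0) > 0`.
  obtain ⟨p₀, ⟨hp₀, hp₀neg⟩, hmin⟩ := hcompact.exists_isLeast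
    ⟨0.44, ⟨by norm_num, le_rfl⟩, (laurentCoeff_self_neg rfl).le⟩
  have hp₀pos : 0 < p₀ := by linarith [hp₀.1]
  have hne : (0.1 : ℝ) < p₀ := by
    refine lt_of_le_of_ne hp₀.1 fun h => ?_
    rw [← h] at hp₀neg
    exact absurd (laurentCoeff_self_pos rfl) (not_lt.2 hp₀neg)
  have hneg : laurentCoeff p₀ (p₀ ^ s) 0 < 0 := by
    refine lt_of_lt_of_le (laurentCoeff_zero_lt hp₀pos hp₀.2 ?_ ?_) hp₀neg
    · simpa using Real.rpow_lt_rpow_of_exponent_gt hp₀pos (by linarith [hp₀.2]) hs1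
    · exact Real.rpow_lt_one hp₀pos.le (by linarith [hp₀.2]) hs0
  have hev : ∀ᶠ p in 𝓝[<] p₀, laurentCoeff p (p ^ s) 0 < 0 := by
    have h : ∀ᶠ p in 𝓝[Set.Icc 0.1 p₀] p₀, laurentCoeff p (p ^ s) 0 < 0 :=
      ((hc2 p₀ hp₀).mono (Set.Icc_subset_Icc_right hp₀.2)).eventually (gt_mem_nhds hneg)
    exact nhdsWithin_Icc_eq_nhdsLE hne ▸ h |> fun h => nhdsWithin_mono _ Set.Iio_subset_Iic_self h
  have hev2 : ∀ᶠ p in 𝓝[<] p₀, p ∈ Set.Ioo 0.1 p₀ := Ioo_mem_nhdsLT hne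
  obtain ⟨p, hpneg, hp⟩ := (hev.and hev2).exists
  refine ⟨p, ⟨by linarith [hp.1], by linarith [hp.2, hp₀.2]⟩, mul_neg_of_pos_of_neg ?_ hpneg⟩
  by_contra! hle
  exact absurd (hmin ⟨⟨hp.1.le, hp.2.le.trans hp₀.2⟩, hle⟩) (not_le.2 hp.2)

lemma exists_besselJ_mul_neg {v : ℝ} (hv : -1 < v) (hv0 : v < 0) :
    ∃ q ∈ Set.Ioo (0 : ℝ) 1, besselJ 0 1 (q ^ 2) * besselJ v 1 (q ^ 2) < 0 := by
  obtain ⟨p, ⟨hp0, hp1⟩, h⟩ := exists_laurentCoeff_mul_neg (s := v + 1) (by linarith) (by linarith)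
  have hq0 : 0 < √p := Real.sqrt_pos.2 hp0
  have hq1 : √p < 1 := by
    rw [Real.sqrt_lt' one_pos]; simpa using hp1
  refine ⟨√p, ⟨hq0, hq1⟩, ?_⟩
  rw [besselJ_one hq0 hq1 hv, besselJ_one hq0 hq1 (by norm_num), zero_add, Real.rpow_one,
    Real.sq_sqrt hp0.le]
  exact h

/-! ### The translation of a point mass -/

lemma fourierBessel_indicator_one {q : ℝ} (hq0 : 0 < q) (hq1 : q < 1) (v x : ℝ) :
    fourierBessel q v (Set.indicator {1} 1) x
      = cConst q v * (1 - q) * besselNorm v x (q ^ 2) := by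
  rw [fourierBessel, jacksonIntegral, tsum_eq_single 0]
  · simp [mul_assoc]
  · intro n hn
    have : q ^ n ≠ 1 := by
      rwa [Ne, zpow_eq_one_iff_right₀ hq0.le hq1.ne]
    simp [this]

/-- The point mass at `1` is a nonnegative integrable test function that isolates a single kernel
value. -/
lemma translation_indicator_one {q : ℝ} (hq0 : 0 < q) (hq1 : q < 1) (v y : ℝ) :
    translation q v 1 (Set.indicator {1} 1) y = (1 - q) * kernelD q v 1 y 1 := by
  rw [translation, kernelD, jacksonIntegral, jacksonIntegral, ← mul_assoc, ← mul_assoc,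
    ← mul_assoc, ← tsum_mul_left, ← tsum_mul_left]
  refine tsum_congr fun n => ?_
  rw [fourierBessel_indicator_one hq0 hq1]
  simp only [one_mul]
  ring

lemma memL1_indicator_one {q : ℝ} (hq0 : 0 < q) (hq1 : q < 1) (v : ℝ) :
    MemL1 q v (Set.indicator {1} 1) := by
  refine summable_of_ne_finset_zero (s := {0}) fun n hn => ?_
  have : q ^ n ≠ 1 := by
    rw [Ne, zpow_eq_one_iff_right₀ hq0.le hq1.ne]; simpa using hn
  simp [this]

lemma notMem_positivityDomain {q v : ℝ} (hq0 : 0 < q) (hq1 : q < 1) {i : ℕ}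
    (h : kernelD q v 1 (q ^ i) 1 < 0) : q ∉ positivityDomain v := by
  rintro ⟨-, hpos⟩
  have h1 := hpos 1 ⟨0, zpow_zero q⟩ (Set.indicator {1} 1) (memL1_indicator_one hq0 hq1 v)
    (fun t _ => Set.indicator_nonneg (fun _ _ => zero_le_one) t) (q ^ i) ⟨i, zpow_natCast q i⟩
  rw [translation_indicator_one hq0 hq1] at h1
  nlinarith

end QBessel

theorem proposition5 (v : ℝ) (hv : -1 < v) (hv0 : v < 0) :
    QBessel.positivityDomain v ⊂ Set.Ioo (0 : ℝ) 1 ∧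
    (∃ q ∈ Set.Ioo (0 : ℝ) 1,
      QBessel.besselJ 0 1 (q ^ 2) * QBessel.besselJ v 1 (q ^ 2) < 0) ∧
    (∀ q ∈ Set.Ioo (0 : ℝ) 1,
      QBessel.besselJ 0 1 (q ^ 2) * QBessel.besselJ v 1 (q ^ 2) < 0 →
      ∃ i : ℕ, QBessel.kernelD q v 1 (q ^ i) 1 < 0) := by
  refine ⟨?_, QBessel.exists_besselJ_mul_neg hv hv0,
    fun q hq h => QBessel.exists_kernelD_neg hq.1 hq.2 hv hv0 h⟩
  obtain ⟨q, hq, h⟩ := QBessel.exists_besselJ_mul_neg hv hv0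
  obtain ⟨i, hi⟩ := QBessel.exists_kernelD_neg hq.1 hq.2 hv hv0 h
  exact (Set.ssubset_iff_of_subset fun q hq => hq.1).2
    ⟨q, hq, QBessel.notMem_positivityDomain hq.1 hq.2 hi⟩
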